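/- Let $\Omega\subseteq\mathbb R^d$ be a bounded open set with $C^1$ boundary and let $f\in C^1(\mathbb R^d;\mathbb R^d)$ be such that for every $z\in\overline\Omega$ the solution $t\mapsto\Phi^t(z)$ of $x'=f(x)$, $x(0)=z$, exists for all $t\ge 0$ and stays in $\overline\Omega$. Let $w$ be a measurable weight that is positive almost everywhere on $\Omega$, with $w^{-1}\in W^{1,\infty}(\Omega)$, $\operatorname{ess\,sup}_\Omega|f_iw|<\infty$ for $i=1,\dots,d$, and $\operatorname{ess\,sup}_{\Omega}\bigl(-f^\top\nabla w/w\bigr)<\infty$, where $\nabla w:=-w^2\nabla(w^{-1})$. Consider the real spaces $$X=L^1(\Omega;w\,dx),\qquad X^*=\{\psi:\ \|\psi\|_{X^*}=\operatorname{ess\,sup}_\Omega|\psi w|<\infty\},\qquad H=L^2(\Omega;w^2\,dx)\subseteq X,$$ with the pairing $\langle\varphi,\psi\rangle=\int_\Omega\varphi\,\psi\,w^2\,dx$, which serves both as the duality between $X$ and $X^*$ and as the inner product of $H$. For $t\ge0$ let $S(t)$ denote the preadjoint, on $X$ and on $H$ respectively, of the composition operator $\psi\mapsto\psi\circ\Phi^t$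 (acting on $X^*$ and on $H^*=H$), i.e. $\langle S(t)\rho,\psi\rangle=\langle\rho,\psi\circ\Phi^t\rangle$, and let $A:\mathcal D(A)\subseteq H\to H$ be the infinitesimal generator of $S(t)$ on $H$. Let $g=\sum_{i\ge1}c_i^2$ on $\Omega$ with $c_i\in X^*$ and $\sum_i\|c_i\|_{X^*}^2<\infty$, and let $C:X\to\ell^2$, $C\varphi=(\langle\varphi,c_i\rangle)_{i}$. Assume that $S(t)$ is exponentially stable on $X$, i.e. there are $M$ and $\omega>0$ with $\|S(t)\|_{\mathcal L(X)}\le Me^{-\omega t}$ for all $t\ge0$. Then for all $\varphi,\psi\in X$ the integral $$\langle\varphi,\psi\rangle_P=\int_0^\infty\langle CS(t)\varphi,CS(t)\psi\rangle_{\ell^2}\,dt$$ converges absolutely and defines a bounded bilinear form on $X$ (the value bilinear form). Among the bounded, symmetric, positive semidefinite bilinear forms $B$ on $H$ that satisfy the operator Lyapunov equation $$B(A\varphi,\psi)+B(\varphi,A\psi)+\langle C\varphi,C\psi\rangle_{\ell^2}=0\qquad\text{for all }\varphi,\psi\in\mathcal D(A)\subseteq H$$ there is exactly one minimal solution $P_H$,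 i.e. exactly one solution with $P_H(\varphi,\varphi)\le B(\varphi,\varphi)$ for all $\varphi\in H$ and every solution $B$; and $\langle\cdot,\cdot\rangle_P$ is the unique bounded bilinear form on $X$ that coincides with $P_H$ on $H\times H$. -/

import Mathlib

open MeasureTheory Set Filter Topology
open scoped ENNReal

/-! ## Weak gradients and the Sobolev space `W^{1,∞}` -/

/-- `G` is the weak gradient of `u` on the open set `Ω`: `∫_Ω u ∇η = - ∫_Ω η G` for every test
function `η ∈ C_c^∞(Ω)`, where `u` and `G` are locally integrable on `Ω`. -/
def HasWeakGradient {d : ℕ} (Ω : Set (EuclideanSpace ℝ (Fin d)))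
    (u : EuclideanSpace ℝ (Fin d) → ℝ)
    (G : EuclideanSpace ℝ (Fin d) → EuclideanSpace ℝ (Fin d)) : Prop :=
  LocallyIntegrableOn u Ω ∧ LocallyIntegrableOn G Ω ∧
    ∀ η : EuclideanSpace ℝ (Fin d) → ℝ, ContDiff ℝ ((⊤ : ℕ∞) : WithTop ℕ∞) η → HasCompactSupport η → tsupport η ⊆ Ω →
      ∫ x in Ω, u x • gradient η x = - ∫ x in Ω, η x • G x

open Classical in
/-- The weak gradient of `u` on `Ω` (determined almost everywhere on `Ω` when it exists). -/
noncomputable def weakGradient {d : ℕ} (Ω : Set (EuclideanSpace ℝ (Fin d)))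
    (u : EuclideanSpace ℝ (Fin d) → ℝ) :
    EuclideanSpace ℝ (Fin d) → EuclideanSpace ℝ (Fin d) :=
  if h : ∃ G, HasWeakGradient Ω u G then h.choose else 0

/-- Membership in the Sobolev space `W^{1,∞}(Ω)`. -/
def MemSobolevOneTop {d : ℕ} (Ω : Set (EuclideanSpace ℝ (Fin d)))
    (u : EuclideanSpace ℝ (Fin d) → ℝ) : Prop :=
  MemLp u ∞ (volume.restrict Ω) ∧
    ∃ G, HasWeakGradient Ω u G ∧ MemLp G ∞ (volume.restrict Ω)

/-! ## Domains with `C^1` boundary and flows -/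

/-- `Ω` has `C^1` boundary: near each boundary point `Ω` is the strict sublevel set `{g < 0}` of a
`C^1` function `g` whose derivative does not vanish there (equivalently, by the implicit function
theorem, `Ω` is locally the region on one side of the graph of a `C^1` function). -/
def HasC1Boundary {d : ℕ} (Ω : Set (EuclideanSpace ℝ (Fin d))) : Prop :=
  ∀ x₀ ∈ frontier Ω, ∃ (U : Set (EuclideanSpace ℝ (Fin d))) (g : EuclideanSpace ℝ (Fin d) → ℝ),
    IsOpen U ∧ x₀ ∈ U ∧ ContDiffOn ℝ 1 g U ∧ fderiv ℝ g x₀ ≠ 0 ∧ Ω ∩ U = {x ∈ U | g x < 0}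

/-- `x` solves `x' = f(x)` on `[0,∞)` with `x(0) = z`. -/
def IsForwardSolution {d : ℕ} (f : EuclideanSpace ℝ (Fin d) → EuclideanSpace ℝ (Fin d))
    (z : EuclideanSpace ℝ (Fin d)) (x : ℝ → EuclideanSpace ℝ (Fin d)) : Prop :=
  x 0 = z ∧ IsIntegralCurveOn x (fun _ => f) (Ici 0)

open Classical in
/-- The flow `Φ^t(z)`: the value at time `t ≥ 0` of the solution of `x' = f(x)`, `x(0) = z`.
(If there is no global forward solution from `z`, the value is `z` by convention.) -/
noncomputable def forwardFlow {d : ℕ} (f : EuclideanSpace ℝ (Fin d) → EuclideanSpace ℝ (Fin d))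
    (t : ℝ) (z : EuclideanSpace ℝ (Fin d)) : EuclideanSpace ℝ (Fin d) :=
  if h : ∃ x, IsForwardSolution f z x then h.choose t else z

/-- `closure Ω` is invariant: from every `z ∈ closure Ω` there starts a solution that exists for
all `t ≥ 0` and stays in `closure Ω` (solutions being unique for `f` of class `C^1`). -/
def FlowInvariant {d : ℕ} (f : EuclideanSpace ℝ (Fin d) → EuclideanSpace ℝ (Fin d))
    (Ω : Set (EuclideanSpace ℝ (Fin d))) : Prop :=
  ∀ z ∈ closure Ω, ∃ x, IsForwardSolution f z x ∧ ∀ t, 0 ≤ t → x t ∈ closure Ω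

/-! ## Operator semigroups -/

/-- The infinitesimal generator of a family `T(t)`, `t ≥ 0`, of bounded operators:
`A φ = lim_{t → 0+} (T(t) φ - φ) / t`, with domain the set of `φ` for which the limit exists. -/
noncomputable def semigroupGenerator {Y : Type*} [NormedAddCommGroup Y] [NormedSpace ℝ Y]
    (T : ℝ → Y →L[ℝ] Y) : Y →ₗ.[ℝ] Y where
  domain :=
    { carrier := {φ | ∃ η, Tendsto (fun t : ℝ => t⁻¹ • (T t φ - φ)) (𝓝[>] 0) (𝓝 η)}
      zero_mem' := ⟨0, by simp⟩
      add_mem' := by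
        rintro φ ψ ⟨η, hη⟩ ⟨ζ, hζ⟩
        refine ⟨η + ζ, (hη.add hζ).congr fun t => ?_⟩
        rw [map_add, ← smul_add]
        congr 1
        abel
      smul_mem' := by
        rintro a φ ⟨η, hη⟩
        refine ⟨a • η, (hη.const_smul a).congr fun t => ?_⟩
        rw [map_smul, smul_comm, smul_sub] }
  toFun :=
    { toFun := fun φ => φ.2.choose
      map_add' := by
        intro φ ψ
        refine tendsto_nhds_unique (φ + ψ).2.choose_spec
          ((φ.2.choose_spec.add ψ.2.choose_spec).congr fun t => ?_)
        rw [Submodule.coe_add, map_add, ← smul_add]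
        congr 1
        abel
      map_smul' := by
        intro a φ
        refine tendsto_nhds_unique (a • φ).2.choose_spec
          ((φ.2.choose_spec.const_smul a).congr fun t => ?_)
        rw [Submodule.coe_smul, map_smul, smul_comm, smul_sub] }

/-- Exponential stability of a family `T(t)`, `t ≥ 0`, of bounded operators. -/
def ExponentiallyStable {Y : Type*} [NormedAddCommGroup Y] [NormedSpace ℝ Y]
    (T : ℝ → Y →L[ℝ] Y) : Prop :=
  ∃ M ω : ℝ, 0 < ω ∧ ∀ t, 0 ≤ t → ‖T t‖ ≤ M * Real.exp (-ω * t)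

/-! ## The dynamical system, the weight and the weighted spaces -/

/-- The standing data: a bounded open set `Ω ⊆ ℝ^d` with `C^1` boundary, a `C^1` vector field `f`
leaving `closure Ω` invariant, and a weight `w`, positive (almost everywhere) on `Ω`, with
`1/w ∈ W^{1,∞}(Ω)`, `f_i ∈ L^∞_w(Ω)` and `- f ⬝ ∇w / w` essentially bounded above. -/
structure KoopmanSystem (d : ℕ) where
  /-- the domain -/
  Ω : Set (EuclideanSpace ℝ (Fin d))
  /-- the vector field -/
  f : EuclideanSpace ℝ (Fin d) → EuclideanSpace ℝ (Fin d)
  /-- the weight -/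
  w : EuclideanSpace ℝ (Fin d) → ℝ
  isOpen : IsOpen Ω
  isBounded : Bornology.IsBounded Ω
  c1Boundary : HasC1Boundary Ω
  contDiff : ContDiff ℝ 1 f
  flowInvariant : FlowInvariant f Ω
  measurable_w : Measurable w
  w_pos : ∀ᵐ x ∂volume.restrict Ω, 0 < w x
  inv_w_sobolev : MemSobolevOneTop Ω (fun x => (w x)⁻¹)
  f_mem : ∀ i, MemLp (fun x => f x i * w x) ∞ (volume.restrict Ω)
  /-- `- f ⬝ ∇w / w ≤ ω₀` almost everywhere. As `w` itself may be singular where `1/w` vanishes,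
  `∇w` is the almost everywhere defined function `- w² ∇(1/w)`. -/
  dissipative : ∃ ω₀ : ℝ, ∀ᵐ x ∂volume.restrict Ω,
    -(inner ℝ (f x) (-(w x ^ 2) • weakGradient Ω (fun y => (w y)⁻¹) x) / w x) ≤ ω₀

namespace KoopmanSystem

/-- Lebesgue measure on `Ω`. -/
noncomputable abbrev vol {d : ℕ} (K : KoopmanSystem d) : Measure (EuclideanSpace ℝ (Fin d)) :=
  volume.restrict K.Ω

/-- The measure `w dx` on `Ω`. -/
noncomputable def μX {d : ℕ} (K : KoopmanSystem d) : Measure (EuclideanSpace ℝ (Fin d)) :=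
  K.vol.withDensity (fun x => ENNReal.ofReal (K.w x))

/-- The measure `w² dx` on `Ω`. -/
noncomputable def μH {d : ℕ} (K : KoopmanSystem d) : Measure (EuclideanSpace ℝ (Fin d)) :=
  K.vol.withDensity (fun x => ENNReal.ofReal (K.w x ^ 2))

/-- The Banach space `X = L^1_w(Ω)`. -/
abbrev X {d : ℕ} (K : KoopmanSystem d) : Type := Lp ℝ 1 K.μX

/-- The Hilbert space `H = L^2_{w²}(Ω)`. -/
abbrev H {d : ℕ} (K : KoopmanSystem d) : Type := Lp ℝ 2 K.μH

/-- `ψ ∈ X^* = L^∞_w(Ω)`, i.e. `ess sup_Ω |ψ w| < ∞`. -/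
def MemDual {d : ℕ} (K : KoopmanSystem d) (ψ : EuclideanSpace ℝ (Fin d) → ℝ) : Prop :=
  MemLp (fun x => ψ x * K.w x) ∞ K.vol

/-- The norm `ess sup_Ω |ψ w|` of `X^* = L^∞_w(Ω)`. -/
noncomputable def dualNorm {d : ℕ} (K : KoopmanSystem d)
    (ψ : EuclideanSpace ℝ (Fin d) → ℝ) : ℝ :=
  (eLpNorm (fun x => ψ x * K.w x) ∞ K.vol).toReal

/-- The pairing `∫_Ω φ ψ w² dx`, which is both the duality of `X` and `X^*` and the inner product
of `H`. -/
noncomputable def pairing {d : ℕ} (K : KoopmanSystem d)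
    (φ ψ : EuclideanSpace ℝ (Fin d) → ℝ) : ℝ :=
  ∫ x, φ x * ψ x * K.w x ^ 2 ∂K.vol

/-! ### The embedding `H ⊆ X` -/

lemma isFiniteMeasure_vol {d : ℕ} (K : KoopmanSystem d) : IsFiniteMeasure K.vol :=
  ⟨by simpa using K.isBounded.measure_lt_top⟩

lemma vol_ac_μX {d : ℕ} (K : KoopmanSystem d) : K.vol ≪ K.μX := by
  refine withDensity_absolutelyContinuous' K.measurable_w.ennreal_ofReal.aemeasurable ?_
  filter_upwards [K.w_pos] with x hx
  simpa using hx

lemma vol_ac_μH {d : ℕ} (K : KoopmanSystem d) : K.vol ≪ K.μH := by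
  refine withDensity_absolutelyContinuous'
    (K.measurable_w.pow_const 2).ennreal_ofReal.aemeasurable ?_
  filter_upwards [K.w_pos] with x hx
  simpa using hx.ne'

lemma μX_ac_vol {d : ℕ} (K : KoopmanSystem d) : K.μX ≪ K.vol :=
  withDensity_absolutelyContinuous _ _

lemma eLpNorm_one_μX {d : ℕ} (K : KoopmanSystem d) (h : EuclideanSpace ℝ (Fin d) → ℝ) :
    eLpNorm h 1 K.μX = eLpNorm (fun x => h x * K.w x) 1 K.vol := by
  rw [eLpNorm_one_eq_lintegral_enorm, eLpNorm_one_eq_lintegral_enorm, μX,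
    lintegral_withDensity_eq_lintegral_mul_non_measurable _ K.measurable_w.ennreal_ofReal
      (Eventually.of_forall fun _ => ENNReal.ofReal_lt_top)]
  refine lintegral_congr_ae ?_
  filter_upwards [K.w_pos] with x hx
  simp [enorm_mul, Real.enorm_of_nonneg hx.le, mul_comm]

lemma eLpNorm_two_μH {d : ℕ} (K : KoopmanSystem d) (h : EuclideanSpace ℝ (Fin d) → ℝ) :
    eLpNorm h 2 K.μH = eLpNorm (fun x => h x * K.w x) 2 K.vol := by
  rw [eLpNorm_eq_lintegral_rpow_enorm_toReal two_ne_zero ENNReal.ofNat_ne_top,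
    eLpNorm_eq_lintegral_rpow_enorm_toReal two_ne_zero ENNReal.ofNat_ne_top, μH,
    lintegral_withDensity_eq_lintegral_mul_non_measurable _
      (K.measurable_w.pow_const 2).ennreal_ofReal
      (Eventually.of_forall fun _ => ENNReal.ofReal_lt_top)]
  congr 1
  refine lintegral_congr_ae ?_
  filter_upwards [K.w_pos] with x hx
  simp [enorm_mul, Real.enorm_of_nonneg hx.le, mul_pow, mul_comm, ENNReal.ofReal_pow hx.le]

lemma eLpNorm_embed_le {d : ℕ} (K : KoopmanSystem d) {h : EuclideanSpace ℝ (Fin d) → ℝ}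
    (hh : AEStronglyMeasurable h K.μH) :
    eLpNorm h 1 K.μX ≤ eLpNorm h 2 K.μH * K.vol univ ^ (2⁻¹ : ℝ) := by
  rw [eLpNorm_one_μX, eLpNorm_two_μH]
  have h1 : AEStronglyMeasurable (fun x => h x * K.w x) K.vol :=
    (hh.mono_ac K.vol_ac_μH).mul K.measurable_w.aestronglyMeasurable
  refine (eLpNorm_le_eLpNorm_mul_rpow_measure_univ (p := 1) (q := 2) (by norm_num) h1).trans_eq ?_
  norm_num

lemma memLp_embed {d : ℕ} (K : KoopmanSystem d) (h : K.H) : MemLp h 1 K.μX := by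
  have := K.isFiniteMeasure_vol
  refine ⟨((Lp.aestronglyMeasurable h).mono_ac K.vol_ac_μH).mono_ac K.μX_ac_vol, ?_⟩
  refine (K.eLpNorm_embed_le (Lp.aestronglyMeasurable h)).trans_lt ?_
  exact ENNReal.mul_lt_top (Lp.eLpNorm_lt_top h)
    (ENNReal.rpow_lt_top_of_nonneg (by norm_num) (measure_ne_top _ _))

/-- The embedding `H = L^2_{w²}(Ω) ⊆ L^1_w(Ω) = X`: a function is sent to itself. -/
noncomputable def embed {d : ℕ} (K : KoopmanSystem d) : K.H →L[ℝ] K.X :=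
  LinearMap.mkContinuous
    { toFun := fun h => (K.memLp_embed h).toLp
      map_add' := by
        intro h k
        refine (MemLp.toLp_congr _ ((K.memLp_embed h).add (K.memLp_embed k)) ?_).trans
          (MemLp.toLp_add _ _)
        exact K.μX_ac_vol.ae_le (K.vol_ac_μH.ae_le (Lp.coeFn_add h k))
      map_smul' := by
        intro a h
        refine (MemLp.toLp_congr _ ((K.memLp_embed h).const_smul a) ?_).trans
          (MemLp.toLp_const_smul _ _)
        exact K.μX_ac_vol.ae_le (K.vol_ac_μH.ae_le (Lp.coeFn_smul a h)) }
    ((K.vol univ ^ (2⁻¹ : ℝ)).toReal) (by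
      intro h
      have := K.isFiniteMeasure_vol
      change ‖(K.memLp_embed h).toLp‖ ≤ _
      rw [Lp.norm_toLp, Lp.norm_def, mul_comm, ← ENNReal.toReal_mul]
      refine ENNReal.toReal_mono ?_ (K.eLpNorm_embed_le (Lp.aestronglyMeasurable h))
      exact (ENNReal.mul_lt_top (Lp.eLpNorm_lt_top h)
        (ENNReal.rpow_lt_top_of_nonneg (by norm_num) (measure_ne_top _ _))).ne)

/-! ### The composition semigroup and its preadjoint -/

/-- `T` is the preadjoint on `X` of the composition operator `ψ ↦ ψ ∘ Φ^t` on `X^*`. -/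
def IsPreadjointX {d : ℕ} (K : KoopmanSystem d) (t : ℝ) (T : K.X →L[ℝ] K.X) : Prop :=
  ∀ (ρ : K.X) (ψ : EuclideanSpace ℝ (Fin d) → ℝ), K.MemDual ψ →
    K.pairing (T ρ) ψ = K.pairing ρ (ψ ∘ forwardFlow K.f t)

/-- `T` is the preadjoint on `H` of the composition operator `ψ ↦ ψ ∘ Φ^t` on `H^* = H`. -/
def IsPreadjointH {d : ℕ} (K : KoopmanSystem d) (t : ℝ) (T : K.H →L[ℝ] K.H) : Prop :=
  ∀ (ρ : K.H) (ψ : EuclideanSpace ℝ (Fin d) → ℝ), MemLp ψ 2 K.μH →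
    K.pairing (T ρ) ψ = K.pairing ρ (ψ ∘ forwardFlow K.f t)

open Classical in
/-- The semigroup `S(t)` on `X`, `t ≥ 0`: the (unique) bounded operator that is the preadjoint of
the composition operator with `Φ^t`. -/
noncomputable def SX {d : ℕ} (K : KoopmanSystem d) (t : ℝ) : K.X →L[ℝ] K.X :=
  if h : ∃ T, K.IsPreadjointX t T then h.choose else 0

open Classical in
/-- The semigroup `S(t)` on `H`, `t ≥ 0`: the (unique) bounded operator that is the preadjoint of
the composition operator with `Φ^t`. -/
noncomputable def SH {d : ℕ} (K : KoopmanSystem d) (t : ℝ) : K.H →L[ℝ] K.H :=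
  if h : ∃ T, K.IsPreadjointH t T then h.choose else 0

/-- The generator `A : D(A) ⊆ H → H` of the semigroup `S(t)` on `H`. -/
noncomputable def A {d : ℕ} (K : KoopmanSystem d) : K.H →ₗ.[ℝ] K.H := semigroupGenerator K.SH

/-! ### Nuclear costs, the observation operator and the value bilinear form -/

/-- A nuclear cost `g = ∑ c_i²` on `Ω`, with `c_i ∈ X^*` and `∑ ‖c_i‖²_{X^*} < ∞`. -/
structure NuclearCost {d : ℕ} (K : KoopmanSystem d) where
  /-- the cost function -/
  g : EuclideanSpace ℝ (Fin d) → ℝ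
  /-- the functions whose squares add up to the cost -/
  c : ℕ → EuclideanSpace ℝ (Fin d) → ℝ
  hasSum : ∀ x ∈ K.Ω, HasSum (fun i => c i x ^ 2) (g x)
  mem_dual : ∀ i, K.MemDual (c i)
  summable : Summable fun i => K.dualNorm (c i) ^ 2

lemma integrable_mul_w {d : ℕ} (K : KoopmanSystem d) (φ : K.X) :
    Integrable (fun x => φ x * K.w x) K.vol := by
  rw [← memLp_one_iff_integrable]
  refine ⟨((Lp.aestronglyMeasurable φ).mono_ac K.vol_ac_μX).mul
    K.measurable_w.aestronglyMeasurable, ?_⟩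
  rw [← eLpNorm_one_μX]
  exact Lp.eLpNorm_lt_top φ

lemma norm_eq_integral {d : ℕ} (K : KoopmanSystem d) (φ : K.X) :
    ‖φ‖ = ∫ x, ‖φ x * K.w x‖ ∂K.vol := by
  rw [Lp.norm_def, eLpNorm_one_μX, integral_norm_eq_lintegral_enorm
    (K.integrable_mul_w φ).aestronglyMeasurable, eLpNorm_one_eq_lintegral_enorm]

lemma ae_le_dualNorm {d : ℕ} (K : KoopmanSystem d) {ψ : EuclideanSpace ℝ (Fin d) → ℝ}
    (hψ : K.MemDual ψ) : ∀ᵐ x ∂K.vol, ‖ψ x * K.w x‖ ≤ K.dualNorm ψ := by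
  have h : eLpNorm (fun x => ψ x * K.w x) ∞ K.vol < ∞ := hψ.2
  rw [eLpNorm_exponent_top] at h
  filter_upwards [ae_le_eLpNormEssSup (f := fun x => ψ x * K.w x) (μ := K.vol)] with x hx
  rw [dualNorm, eLpNorm_exponent_top, ← toReal_enorm]
  exact ENNReal.toReal_mono h.ne hx

lemma integrable_pairing {d : ℕ} (K : KoopmanSystem d) (φ : K.X)
    {ψ : EuclideanSpace ℝ (Fin d) → ℝ} (hψ : K.MemDual ψ) :
    Integrable (fun x => φ x * ψ x * K.w x ^ 2) K.vol := by
  refine ((K.integrable_mul_w φ).mul_bdd hψ.1 (K.ae_le_dualNorm hψ)).congr ?_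
  exact Eventually.of_forall fun x => by simp only; ring

lemma abs_pairing_le {d : ℕ} (K : KoopmanSystem d) (φ : K.X)
    {ψ : EuclideanSpace ℝ (Fin d) → ℝ} (hψ : K.MemDual ψ) :
    |K.pairing φ ψ| ≤ K.dualNorm ψ * ‖φ‖ := by
  rw [K.norm_eq_integral, ← integral_const_mul, ← Real.norm_eq_abs, pairing]
  refine norm_integral_le_of_norm_le ((K.integrable_mul_w φ).norm.const_mul _) ?_
  filter_upwards [K.ae_le_dualNorm hψ] with x hx
  calc ‖φ x * ψ x * K.w x ^ 2‖ = ‖ψ x * K.w x‖ * ‖φ x * K.w x‖ := by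
        rw [← norm_mul]; congr 1; ring
    _ ≤ _ := mul_le_mul_of_nonneg_right hx (norm_nonneg _)

/-- The functional `φ ↦ ⟨φ, ψ⟩_{X,X^*}` for `ψ ∈ X^*`. -/
noncomputable def dualFunctional {d : ℕ} (K : KoopmanSystem d)
    (ψ : EuclideanSpace ℝ (Fin d) → ℝ) (hψ : K.MemDual ψ) : K.X →L[ℝ] ℝ :=
  LinearMap.mkContinuous
    { toFun := fun φ => K.pairing φ ψ
      map_add' := by
        intro φ φ'
        rw [pairing, pairing, pairing,
          ← integral_add (K.integrable_pairing φ hψ) (K.integrable_pairing φ' hψ)]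
        refine integral_congr_ae ?_
        filter_upwards [K.vol_ac_μX.ae_le (Lp.coeFn_add φ φ')] with x hx
        rw [hx, Pi.add_apply]
        ring
      map_smul' := by
        intro a φ
        rw [pairing, pairing, RingHom.id_apply, smul_eq_mul, ← integral_const_mul]
        refine integral_congr_ae ?_
        filter_upwards [K.vol_ac_μX.ae_le (Lp.coeFn_smul a φ)] with x hx
        rw [hx, Pi.smul_apply, smul_eq_mul]
        ring }
    (K.dualNorm ψ) (fun φ => K.abs_pairing_le φ hψ)

namespace NuclearCost

lemma sq_le {d : ℕ} {K : KoopmanSystem d} (N : K.NuclearCost) (φ : K.X) (i : ℕ) :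
    ‖K.dualFunctional (N.c i) (N.mem_dual i) φ‖ ^ 2 ≤ K.dualNorm (N.c i) ^ 2 * ‖φ‖ ^ 2 := by
  rw [← mul_pow]
  exact pow_le_pow_left₀ (norm_nonneg _) (K.abs_pairing_le φ (N.mem_dual i)) 2

lemma memℓp {d : ℕ} {K : KoopmanSystem d} (N : K.NuclearCost) (φ : K.X) :
    Memℓp (fun i => K.dualFunctional (N.c i) (N.mem_dual i) φ) 2 := by
  refine memℓp_gen ?_
  simp only [ENNReal.toReal_ofNat, Real.rpow_ofNat]
  exact Summable.of_nonneg_of_le (fun i => by positivity) (N.sq_le φ) (N.summable.mul_right _)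

/-- The observation operator `C : X → ℓ²`, `φ ↦ (⟨φ, c_i⟩_{X,X^*})_i`. -/
noncomputable def C {d : ℕ} {K : KoopmanSystem d} (N : K.NuclearCost) :
    K.X →L[ℝ] lp (fun _ : ℕ => ℝ) 2 :=
  LinearMap.mkContinuous
    { toFun := fun φ => ⟨fun i => K.dualFunctional (N.c i) (N.mem_dual i) φ, N.memℓp φ⟩
      map_add' := fun φ φ' => by ext i; simp; rfl
      map_smul' := fun a φ => by ext i; simp }
    (Real.sqrt (∑' i, K.dualNorm (N.c i) ^ 2)) (by
      intro φ
      refine lp.norm_le_of_forall_sum_le (by norm_num) (by positivity) fun s => ?_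
      simp only [ENNReal.toReal_ofNat, Real.rpow_ofNat]
      rw [mul_pow, Real.sq_sqrt (tsum_nonneg fun i => sq_nonneg _)]
      refine (Finset.sum_le_sum fun i _ => N.sq_le φ i).trans ?_
      rw [← Finset.sum_mul]
      exact mul_le_mul_of_nonneg_right
        (N.summable.sum_le_tsum s fun i _ => sq_nonneg _) (sq_nonneg _))

/-- The value bilinear form `⟨φ, ψ⟩_P = ∫_0^∞ ⟨C S(t) φ, C S(t) ψ⟩_{ℓ²} dt` on `X`. -/
noncomputable def valueForm {d : ℕ} {K : KoopmanSystem d} (N : K.NuclearCost) (φ ψ : K.X) : ℝ :=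
  ∫ t in Ioi (0 : ℝ), inner ℝ (N.C (K.SX t φ)) (N.C (K.SX t ψ))

/-- `B` is a bounded, symmetric, positive semidefinite bilinear form on `H` that solves the
operator Lyapunov equation `B(Aφ, ψ) + B(φ, Aψ) + ⟨Cφ, Cψ⟩ = 0` for `φ, ψ ∈ D(A)`. -/
def IsLyapunovSolution {d : ℕ} {K : KoopmanSystem d} (N : K.NuclearCost)
    (B : K.H →L[ℝ] K.H →L[ℝ] ℝ) : Prop :=
  (∀ φ ψ, B φ ψ = B ψ φ) ∧ (∀ φ, 0 ≤ B φ φ) ∧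
    ∀ φ ψ : K.A.domain,
      B (K.A φ) ψ + B φ (K.A ψ) + inner ℝ (N.C (K.embed φ)) (N.C (K.embed ψ)) = 0

/-- `B` is the minimal (i.e. smallest) solution of the operator Lyapunov equation on `H`, with
respect to the order `B ≤ B'` iff `B(φ, φ) ≤ B'(φ, φ)` for all `φ`. -/
def IsMinimalLyapunovSolution {d : ℕ} {K : KoopmanSystem d} (N : K.NuclearCost)
    (B : K.H →L[ℝ] K.H →L[ℝ] ℝ) : Prop :=
  N.IsLyapunovSolution B ∧ ∀ B', N.IsLyapunovSolution B' → ∀ φ, B φ φ ≤ B' φ φ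

end NuclearCost

end KoopmanSystem

/-! On `H` everything rests on one identity. If `B` solves the Lyapunov equation and `φ` lies in the
domain of `A`, then `s ↦ B(S(s)φ, S(s)φ)` has right derivative `-‖C S(s)φ‖²`, so the energy observed
up to time `t` is `B(φ, φ) - B(S(t)φ, S(t)φ)`, which is at most `B(φ, φ)`. Letting `t → ∞` and using
density of the domain, the value form restricted to `H` lies below every solution. Stability is
assumed on `X` only, so `B(S(t)φ, S(t)φ)` need not vanish in the limit; this is why a minimal
solution is singled out. The value form is itself a solution: a shift of the time integral gives
`⟨S(s)φ, S(s)ψ⟩_P = ⟨φ, ψ⟩_P - ∫_0^s ⟨C S(t)φ, C S(t)ψ⟩ dt`, to be differentiated at `s = 0`.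
Polarization makes the minimal solution unique, and density of `H` in `X` makes the bounded
extension unique.

The main work is to show that `S(t)` exists on both spaces, is strongly continuous on `H`, and that
the two versions agree. Three facts about the flow carry this. The open set `Ω` is invariant,
because it is the interior of its closure. By backward Gronwall the flow compresses volumes at most
by an exponential factor (`map_flow_le`), so composition respects null sets. Finally `u = 1/w`
satisfies `u ∘ Φ^t ≤ exp(κt) u` almost everywhere (`exists_growth`): dissipativity says `f · ∇u ≤ ω₀
u`, and mollification yields a fundamental theorem of calculus for `u` along almost every trajectory
(`ae_flow_formula`).

Composition is then bounded on `X*` and on `H`. On `H` the semigroup is the Hilbert adjoint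
(`SH_eq`); on `X` it is the continuous extension from the dense subspace `H` (`SX_embed`). -/

/-! ## Strongly continuous semigroups -/

/-- `T` is a strongly continuous semigroup with growth bound `‖T t‖ ≤ exp (κ t)`. -/
structure IsC0Semigroup {Y : Type*} [NormedAddCommGroup Y] [NormedSpace ℝ Y]
    (T : ℝ → Y →L[ℝ] Y) (κ : ℝ) : Prop where
  zero : ∀ φ, T 0 φ = φ
  add : ∀ s t, 0 ≤ s → 0 ≤ t → ∀ φ, T (s + t) φ = T s (T t φ)
  norm_le : ∀ t, 0 ≤ t → ‖T t‖ ≤ Real.exp (κ * t)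
  tendsto_zero : ∀ φ, Tendsto (fun t => T t φ) (𝓝[>] 0) (𝓝 φ)

namespace IsC0Semigroup

variable {Y : Type*} [NormedAddCommGroup Y] [NormedSpace ℝ Y] {T : ℝ → Y →L[ℝ] Y} {κ : ℝ}

/-- Right continuity at `0` and the growth bound suffice on both sides, because `T b φ - T a φ = T a
(T (b - a) φ - φ)` for `a ≤ b`. -/
lemma continuousOn (h : IsC0Semigroup T κ) (φ : Y) : ContinuousOn (fun t => T t φ) (Ici 0) := by
  have h0 : Tendsto (fun t => ‖T t φ - φ‖) (𝓝[≥] 0) (𝓝 0) := by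
    rw [← Ioi_insert, nhdsWithin_insert, tendsto_sup, tendsto_pure_left]
    refine ⟨fun s hs => ?_, ?_⟩
    · simp only [h.zero, sub_self, norm_zero]; exact mem_of_mem_nhds hs
    · simpa using ((h.tendsto_zero φ).sub_const φ).norm
  intro t₀ ht₀
  rw [ContinuousWithinAt, tendsto_iff_norm_sub_tendsto_zero]
  have habs : Tendsto (fun t : ℝ => |t - t₀|) (𝓝[Ici 0] t₀) (𝓝[≥] 0) := by
    refine tendsto_nhdsWithin_iff.2 ⟨?_, Eventually.of_forall fun t => mem_Ici.2 (abs_nonneg _)⟩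
    have : Tendsto (fun t : ℝ => |t - t₀|) (𝓝 t₀) (𝓝 |t₀ - t₀|) :=
      (continuous_id.sub continuous_const).abs.tendsto t₀
    simp only [sub_self, abs_zero] at this
    exact this.mono_left nhdsWithin_le_nhds
  have hexp : Tendsto (fun t : ℝ => Real.exp (|κ| * (t + t₀))) (𝓝[Ici 0] t₀)
      (𝓝 (Real.exp (|κ| * (t₀ + t₀)))) := by
    have : Continuous fun t : ℝ => Real.exp (|κ| * (t + t₀)) := by fun_prop
    exact (this.tendsto t₀).mono_left nhdsWithin_le_nhds
  have hlim := hexp.mul (h0.comp habs)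
  rw [mul_zero] at hlim
  refine squeeze_zero' (Eventually.of_forall fun _ => norm_nonneg _) ?_ hlim
  filter_upwards [self_mem_nhdsWithin] with t ht
  have ht : (0 : ℝ) ≤ t := ht
  have ht₀ : (0 : ℝ) ≤ t₀ := ht₀
  -- The exponent `|κ| (t + t₀)` dominates `κ a` whatever the sign of `κ`, so one estimate serves
  -- both orders of `t` and `t₀`.
  have key : ∀ a b : ℝ, 0 ≤ a → a ≤ b → b ≤ t + t₀ →
      ‖T b φ - T a φ‖ ≤ Real.exp (|κ| * (t + t₀)) * ‖T (b - a) φ - φ‖ := by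
    intro a b ha hab hb
    have e : T b φ = T a (T (b - a) φ) := by
      rw [← h.add a (b - a) ha (by linarith)]; congr 2; ring
    rw [e, ← map_sub]
    refine (T a).le_of_opNorm_le ((h.norm_le a ha).trans (Real.exp_le_exp.2 ?_)) _
    nlinarith [le_abs_self κ, abs_nonneg κ, mul_le_mul_of_nonneg_right (le_abs_self κ) ha,
      mul_le_mul_of_nonneg_left (show a ≤ t + t₀ by linarith) (abs_nonneg κ)]
  simp only [Function.comp]
  rcases le_total t₀ t with hle | hle
  · rw [abs_of_nonneg (sub_nonneg.2 hle)]
    exact key t₀ t ht₀ hle (by linarith)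
  · rw [abs_of_nonpos (sub_nonpos.2 hle), neg_sub, norm_sub_rev]
    exact key t t₀ ht hle (by linarith)

lemma generator_tendsto (φ : (semigroupGenerator T).domain) :
    Tendsto (fun t : ℝ => t⁻¹ • (T t φ - (φ : Y))) (𝓝[>] 0) (𝓝 (semigroupGenerator T φ)) :=
  φ.2.choose_spec

lemma hasDerivWithinAt (h : IsC0Semigroup T κ) (φ : (semigroupGenerator T).domain) {s : ℝ}
    (hs : 0 ≤ s) :
    HasDerivWithinAt (fun t => T t (φ : Y)) (T s (semigroupGenerator T φ)) (Ioi s) s := by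
  rw [hasDerivWithinAt_iff_tendsto_slope' (by simp)]
  have h1 : Tendsto (fun t : ℝ => t - s) (𝓝[>] s) (𝓝[>] 0) := by
    refine tendsto_nhdsWithin_iff.2 ⟨?_, ?_⟩
    · have : Tendsto (fun t : ℝ => t - s) (𝓝 s) (𝓝 (s - s)) :=
        (continuous_id.sub continuous_const).tendsto s
      rw [sub_self] at this
      exact this.mono_left nhdsWithin_le_nhds
    · filter_upwards [self_mem_nhdsWithin] with t ht
      exact mem_Ioi.2 (sub_pos.2 (mem_Ioi.1 ht))
  refine (((T s).continuous.tendsto _).comp ((generator_tendsto φ).comp h1)).congr' ?_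
  filter_upwards [self_mem_nhdsWithin] with t ht
  have ht : s < t := ht
  have e : T t (φ : Y) = T s (T (t - s) φ) := by
    rw [← h.add s (t - s) hs (by linarith)]; congr 2; ring
  simp only [Function.comp, slope, vsub_eq_sub, map_smul, map_sub, e]

/-- `T s` is continuous and commutes with the difference quotients that define the generator. -/
lemma mem_domain (h : IsC0Semigroup T κ) (φ : (semigroupGenerator T).domain) {s : ℝ}
    (hs : 0 ≤ s) : ∃ m : T s (φ : Y) ∈ (semigroupGenerator T).domain,
      semigroupGenerator T ⟨T s φ, m⟩ = T s (semigroupGenerator T φ) := by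
  have key : Tendsto (fun t : ℝ => t⁻¹ • (T t (T s φ) - T s (φ : Y))) (𝓝[>] 0)
      (𝓝 (T s (semigroupGenerator T φ))) := by
    refine (((T s).continuous.tendsto _).comp (generator_tendsto φ)).congr' ?_
    filter_upwards [self_mem_nhdsWithin] with t ht
    have ht : 0 < t := ht
    simp only [Function.comp, map_smul, map_sub]
    rw [← h.add t s ht.le hs, add_comm, h.add s t hs ht.le]
  exact ⟨⟨_, key⟩, tendsto_nhds_unique (generator_tendsto ⟨T s φ, ⟨_, key⟩⟩) key⟩

lemma intervalIntegrable (h : IsC0Semigroup T κ) (φ : Y) {a b : ℝ} (ha : 0 ≤ a) (hb : 0 ≤ b) :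
    IntervalIntegrable (fun t => T t φ) volume a b :=
  ((h.continuousOn φ).mono fun _ ht => (le_min ha hb).trans ht.1).intervalIntegrable

lemma tendsto_average (h : IsC0Semigroup T κ) [CompleteSpace Y] (φ : Y) {s : ℝ} (hs : 0 ≤ s) :
    Tendsto (fun r : ℝ => r⁻¹ • ∫ t in s..(s + r), T t φ) (𝓝[>] 0) (𝓝 (T s φ)) := by
  have hc := h.continuousOn φ
  have hsub : Ioi s ⊆ Ici 0 := fun t ht => hs.trans (le_of_lt ht)
  have hd : HasDerivWithinAt (fun r => ∫ t in s..r, T t φ) (T s φ) (Ioi s) s := by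
    refine (intervalIntegral.integral_hasDerivWithinAt_right (by simp) (s := Ici s) (t := Ioi s)
      ?_ ?_).mono Ioi_subset_Ici_self
    · exact ⟨Ioi s, self_mem_nhdsWithin,
        ((hc.mono hsub).aestronglyMeasurable measurableSet_Ioi)⟩
    · exact (hc s hs).mono hsub
  rw [hasDerivWithinAt_iff_tendsto_slope' (by simp)] at hd
  have h1 : Tendsto (fun r : ℝ => s + r) (𝓝[>] 0) (𝓝[>] s) := by
    refine tendsto_nhdsWithin_iff.2 ⟨?_, ?_⟩
    · have : Tendsto (fun t : ℝ => s + t) (𝓝 0) (𝓝 (s + 0)) :=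
        (continuous_const.add continuous_id).tendsto 0
      rw [add_zero] at this
      exact this.mono_left nhdsWithin_le_nhds
    · filter_upwards [self_mem_nhdsWithin] with t ht
      have ht : 0 < t := ht
      exact mem_Ioi.2 (by linarith)
  refine (hd.comp h1).congr fun r => ?_
  simp [slope]

/-- The averages `r⁻¹ ∫_0^r T t φ dt` converge to `φ` as `r → 0+` and belong to the domain, since
`(T t - 1) ∫_0^r` telescopes to `∫_r^{r+t} - ∫_0^t`. -/
lemma dense_domain (h : IsC0Semigroup T κ) [CompleteSpace Y] :
    Dense ((semigroupGenerator T).domain : Set Y) := by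
  intro φ
  have hav := h.tendsto_average φ le_rfl
  simp only [zero_add, h.zero] at hav
  refine mem_closure_of_tendsto hav ?_
  filter_upwards [self_mem_nhdsWithin] with r hr
  have hr : 0 < r := hr
  refine Submodule.smul_mem _ _ ⟨T r φ - φ, ?_⟩
  have hlim := (h.tendsto_average φ hr.le).sub (h.tendsto_average φ le_rfl)
  simp only [h.zero] at hlim
  refine hlim.congr' ?_
  filter_upwards [self_mem_nhdsWithin] with t ht
  have ht : 0 < t := ht
  rw [← smul_sub]
  congr 1
  have e : T t (∫ s in (0 : ℝ)..r, T s φ) = ∫ s in t..(r + t), T s φ := by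
    rw [← ContinuousLinearMap.intervalIntegral_comp_comm _
      (h.intervalIntegrable φ le_rfl hr.le)]
    rw [show (∫ s in t..(r + t), T s φ) = ∫ s in (0 + t)..(r + t), T s φ by rw [zero_add],
      ← intervalIntegral.integral_comp_add_right (fun s => T s φ)]
    refine intervalIntegral.integral_congr fun s hs => ?_
    rw [uIcc_of_le hr.le] at hs
    rw [add_comm s t, h.add t s ht.le hs.1]
  rw [e, zero_add]
  have i1 := intervalIntegral.integral_add_adjacent_intervals
    (h.intervalIntegrable φ (le_refl 0) ht.le) (h.intervalIntegrable φ ht.le (by linarith : 0 ≤ r + t))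
  have i2 := intervalIntegral.integral_add_adjacent_intervals
    (h.intervalIntegrable φ (le_refl 0) hr.le) (h.intervalIntegrable φ hr.le (by linarith : 0 ≤ r + t))
  rw [sub_eq_sub_iff_add_eq_add, add_comm r t] at *
  rw [add_comm _ (∫ s in (0:ℝ)..t, T s φ), i1, add_comm, i2]

/-- Along the semigroup, a solution of the Lyapunov equation decreases by the observed energy. -/
lemma lyapunov_identity (h : IsC0Semigroup T κ) {Z : Type*} [NormedAddCommGroup Z]
    [InnerProductSpace ℝ Z] (L : Y →L[ℝ] Z) (B : Y →L[ℝ] Y →L[ℝ] ℝ)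
    (hB : ∀ φ ψ : (semigroupGenerator T).domain,
      B (semigroupGenerator T φ) ψ + B φ (semigroupGenerator T ψ) + inner ℝ (L φ) (L ψ) = 0)
    (φ : (semigroupGenerator T).domain) {t : ℝ} (ht : 0 ≤ t) :
    ∫ s in (0 : ℝ)..t, ‖L (T s φ)‖ ^ 2 = B φ φ - B (T t φ) (T t φ) := by
  have hc : ContinuousOn (fun s => T s (φ : Y)) (Icc 0 t) :=
    (h.continuousOn φ).mono Icc_subset_Ici_self
  have hcL : ContinuousOn (fun s => -‖L (T s (φ : Y))‖ ^ 2) (uIcc 0 t) := by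
    rw [uIcc_of_le ht]
    exact ((L.continuous.comp_continuousOn hc).norm.pow 2).neg
  -- This form of the fundamental theorem asks for right derivatives only, which is all that the
  -- one-sided generator provides.
  have key := intervalIntegral.integral_eq_sub_of_hasDeriv_right_of_le ht
    (f := fun s => B (T s φ) (T s φ)) (f' := fun s => -‖L (T s (φ : Y))‖ ^ 2)
    ((B.continuous.comp_continuousOn hc).clm_apply hc) ?_ hcL.intervalIntegrable
  · rw [intervalIntegral.integral_neg, h.zero] at key
    linarith
  · intro s hs
    have hd := h.hasDerivWithinAt φ hs.1.le
    obtain ⟨m, hm⟩ := h.mem_domain φ hs.1.le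
    have h2 := (B.hasFDerivAt.comp_hasDerivWithinAt s hd).clm_apply hd
    refine h2.congr_deriv ?_
    have h3 := hB ⟨_, m⟩ ⟨_, m⟩
    rw [hm, real_inner_self_eq_norm_sq] at h3
    simp only [Function.comp] at h3 ⊢
    linarith

end IsC0Semigroup

/-! ## Autonomous differential equations -/

section ODE

variable {E : Type*} [NormedAddCommGroup E] [NormedSpace ℝ E]

/-- Gronwall's inequality, forward in time. -/
lemma dist_le_exp_of_isIntegralCurveOn {f : E → E} {L : NNReal} {s : Set E}
    (hL : LipschitzOnWith L f s) {x y : ℝ → E} {a b : ℝ} (hab : a ≤ b)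
    (hx : IsIntegralCurveOn x (fun _ => f) (Icc a b)) (hxs : ∀ t ∈ Icc a b, x t ∈ s)
    (hy : IsIntegralCurveOn y (fun _ => f) (Icc a b)) (hys : ∀ t ∈ Icc a b, y t ∈ s) :
    dist (x b) (y b) ≤ dist (x a) (y a) * Real.exp (L * (b - a)) := by
  have hn : ∀ t ∈ Ico a b, Icc a b ∈ 𝓝[≥] t := fun t ht =>
    mem_of_superset (Icc_mem_nhdsGE ht.2) (Icc_subset_Icc_left ht.1)
  exact dist_le_of_trajectories_ODE_of_mem (v := fun _ => f) (s := fun _ => s)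
    (fun _ _ => hL) hx.continuousOn
    (fun t ht => (hx t (Ico_subset_Icc_self ht)).mono_of_mem_nhdsWithin (hn t ht))
    (fun t ht => hxs t (Ico_subset_Icc_self ht)) hy.continuousOn
    (fun t ht => (hy t (Ico_subset_Icc_self ht)).mono_of_mem_nhdsWithin (hn t ht))
    (fun t ht => hys t (Ico_subset_Icc_self ht)) le_rfl b (right_mem_Icc.2 hab)

lemma IsIntegralCurveOn.reverse {f : E → E} {x : ℝ → E} {a b : ℝ}
    (hx : IsIntegralCurveOn x (fun _ => f) (Icc a b)) :
    IsIntegralCurveOn (fun t => x (-t)) (fun _ => -f) (Icc (-b) (-a)) := by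
  intro t ht
  have ht' : -t ∈ Icc a b := ⟨le_neg.2 ht.2, neg_le.2 ht.1⟩
  have := (hx (-t) ht').scomp t (hasDerivWithinAt_neg t (Icc (-b) (-a)))
    (fun s hs => ⟨le_neg.2 hs.2, neg_le.2 hs.1⟩)
  simpa [Function.comp_def] using this

/-- Gronwall's inequality, backward in time. -/
lemma dist_le_exp_of_isIntegralCurveOn_backward {f : E → E} {L : NNReal} {s : Set E}
    (hL : LipschitzOnWith L f s) {x y : ℝ → E} {a b : ℝ} (hab : a ≤ b)
    (hx : IsIntegralCurveOn x (fun _ => f) (Icc a b)) (hxs : ∀ t ∈ Icc a b, x t ∈ s)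
    (hy : IsIntegralCurveOn y (fun _ => f) (Icc a b)) (hys : ∀ t ∈ Icc a b, y t ∈ s) :
    dist (x a) (y a) ≤ dist (x b) (y b) * Real.exp (L * (b - a)) := by
  have hm : ∀ t ∈ Icc (-b) (-a), -t ∈ Icc a b := fun t ht => ⟨le_neg.2 ht.2, neg_le.2 ht.1⟩
  have hL' : LipschitzOnWith L (-f) s := fun p hp q hq => by
    simpa [edist_neg_neg] using hL hp hq
  have := dist_le_exp_of_isIntegralCurveOn hL' (neg_le_neg hab) hx.reverse
    (fun t ht => hxs _ (hm t ht)) hy.reverse (fun t ht => hys _ (hm t ht))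
  simp only [neg_neg] at this
  convert this using 3
  ring

lemma exists_lipschitzOnWith_of_isCompact [FiniteDimensional ℝ E] {f : E → E}
    (hf : ContDiff ℝ 1 f) {s : Set E} (hs : IsCompact s) : ∃ L, LipschitzOnWith L f s :=
  LocallyLipschitzOn.exists_lipschitzOnWith_of_compact hs
    (hf.locallyLipschitz.locallyLipschitzOn)

/-- Two curves on a compact interval sweep out a compact set, where a `C¹` field is Lipschitz.
Uniqueness thus needs neither a global Lipschitz bound nor an a priori invariant set. -/
lemma exists_lipschitzOnWith_of_curves [FiniteDimensional ℝ E] {f : E → E}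
    (hf : ContDiff ℝ 1 f) {x y : ℝ → E} {a b : ℝ} (hx : ContinuousOn x (Icc a b))
    (hy : ContinuousOn y (Icc a b)) :
    ∃ L, LipschitzOnWith L f (x '' Icc a b ∪ y '' Icc a b) :=
  exists_lipschitzOnWith_of_isCompact hf
    ((isCompact_Icc.image_of_continuousOn hx).union (isCompact_Icc.image_of_continuousOn hy))

/-- Uniqueness forward in time. -/
lemma IsIntegralCurveOn.eq_right [FiniteDimensional ℝ E] {f : E → E}
    (hf : ContDiff ℝ 1 f) {x y : ℝ → E} {a b : ℝ} (hab : a ≤ b)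
    (hx : IsIntegralCurveOn x (fun _ => f) (Icc a b))
    (hy : IsIntegralCurveOn y (fun _ => f) (Icc a b)) (h : x a = y a) : x b = y b := by
  obtain ⟨L, hL⟩ := exists_lipschitzOnWith_of_curves hf hx.continuousOn hy.continuousOn
  have := dist_le_exp_of_isIntegralCurveOn hL hab hx
    (fun t ht => Or.inl (mem_image_of_mem x ht)) hy (fun t ht => Or.inr (mem_image_of_mem y ht))
  rwa [h, dist_self, zero_mul, dist_le_zero] at this

/-- Uniqueness backward in time. -/
lemma IsIntegralCurveOn.eq_left [FiniteDimensional ℝ E] {f : E → E}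
    (hf : ContDiff ℝ 1 f) {x y : ℝ → E} {a b : ℝ} (hab : a ≤ b)
    (hx : IsIntegralCurveOn x (fun _ => f) (Icc a b))
    (hy : IsIntegralCurveOn y (fun _ => f) (Icc a b)) (h : x b = y b) : x a = y a := by
  obtain ⟨L, hL⟩ := exists_lipschitzOnWith_of_curves hf hx.continuousOn hy.continuousOn
  have := dist_le_exp_of_isIntegralCurveOn_backward hL hab hx
    (fun t ht => Or.inl (mem_image_of_mem x ht)) hy (fun t ht => Or.inr (mem_image_of_mem y ht))
  rwa [h, dist_self, zero_mul, dist_le_zero] at this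

end ODE

/-! ### Boundary geometry, invariance of the open domain and regularity of the flow -/

/-- A domain with `C¹` boundary is the interior of its closure. -/
lemma HasC1Boundary.interior_closure_subset {d : ℕ} {Ω : Set (EuclideanSpace ℝ (Fin d))}
    (h : HasC1Boundary Ω) (ho : IsOpen Ω) : interior (closure Ω) ⊆ Ω := by
  intro x hx
  by_contra hxΩ
  have hfr : x ∈ frontier Ω := by
    rw [ho.frontier_eq]; exact ⟨interior_subset hx, hxΩ⟩
  obtain ⟨U, g, hU, hxU, hg, hd, hΩ⟩ := h x hfr
  have hgd : HasFDerivAt g (fderiv ℝ g x) x :=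
    ((hg.contDiffAt (hU.mem_nhds hxU)).differentiableAt one_ne_zero).hasFDerivAt
  -- Near `x` the points of `Ω` are dense, which forces `g ≤ 0` there, while `x ∉ Ω` forces `g x ≥
  -- 0`. A local maximum contradicts the nonvanishing derivative.
  have hloc : IsLocalMax g x := by
    have hle : ∀ y ∈ U ∩ interior (closure Ω), g y ≤ 0 := by
      intro y hy
      by_contra! hpos
      have hcont : ContinuousAt g y := hg.continuousOn.continuousAt (hU.mem_nhds hy.1)
      have hn : {z | 0 < g z} ∩ U ∈ 𝓝 y :=
        inter_mem (hcont.eventually (lt_mem_nhds hpos)) (hU.mem_nhds hy.1)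
      obtain ⟨z, hz, hzΩ⟩ := mem_closure_iff_nhds.1 (interior_subset hy.2) _ hn
      have : z ∈ {x ∈ U | g x < 0} := hΩ ▸ ⟨hzΩ, hz.2⟩
      exact absurd hz.1 (not_lt.2 this.2.le)
    have hx0 : 0 ≤ g x := by
      by_contra! hneg
      have : x ∈ Ω ∩ U := hΩ ▸ (⟨hxU, hneg⟩ : x ∈ {x ∈ U | g x < 0})
      exact hxΩ this.1
    filter_upwards [hU.mem_nhds hxU, isOpen_interior.mem_nhds hx] with y h1 h2
    exact (hle y ⟨h1, h2⟩).trans hx0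
  exact hd hloc.fderiv_eq_zero

namespace KoopmanSystem

variable {d : ℕ} (K : KoopmanSystem d)

local notation "E" => EuclideanSpace ℝ (Fin d)

lemma isCompact_closure : IsCompact (closure K.Ω) := K.isBounded.isCompact_closure

lemma isForwardSolution_forwardFlow {z : E} (hz : z ∈ closure K.Ω) :
    IsForwardSolution K.f z (fun t => forwardFlow K.f t z) := by
  have h : ∃ x, IsForwardSolution K.f z x := (K.flowInvariant z hz).imp fun _ hx => hx.1
  have e : (fun t => forwardFlow K.f t z) = h.choose := by
    ext1 t; rw [forwardFlow, dif_pos h]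
  rw [e]
  exact h.choose_spec

lemma IsForwardSolution_eq {x : ℝ → E} {z : E} (hz : z ∈ closure K.Ω)
    (hx : IsForwardSolution K.f z x) {t : ℝ} (ht : 0 ≤ t) : x t = forwardFlow K.f t z := by
  have h := K.isForwardSolution_forwardFlow hz
  exact IsIntegralCurveOn.eq_right K.contDiff ht (hx.2.mono Icc_subset_Ici_self)
    (h.2.mono Icc_subset_Ici_self) (hx.1.trans h.1.symm)

lemma forwardFlow_mem_closure {z : E} (hz : z ∈ closure K.Ω) {t : ℝ} (ht : 0 ≤ t) :
    forwardFlow K.f t z ∈ closure K.Ω := by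
  obtain ⟨x, hx, hxm⟩ := K.flowInvariant z hz
  rw [← K.IsForwardSolution_eq hz hx ht]
  exact hxm t ht

lemma forwardFlow_zero {z : E} (hz : z ∈ closure K.Ω) : forwardFlow K.f 0 z = z :=
  (K.isForwardSolution_forwardFlow hz).1

lemma isIntegralCurveOn_forwardFlow {z : E} (hz : z ∈ closure K.Ω) :
    IsIntegralCurveOn (fun t => forwardFlow K.f t z) (fun _ => K.f) (Ici 0) :=
  (K.isForwardSolution_forwardFlow hz).2

lemma continuousOn_forwardFlow {z : E} (hz : z ∈ closure K.Ω) :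
    ContinuousOn (fun t => forwardFlow K.f t z) (Ici 0) :=
  (K.isIntegralCurveOn_forwardFlow hz).continuousOn

lemma isIntegralCurveOn_forwardFlow_add {z : E} (hz : z ∈ closure K.Ω) (τ : ℝ) :
    IsIntegralCurveOn (fun t => forwardFlow K.f (t + τ) z) (fun _ => K.f) (Ici (-τ)) := by
  refine ((K.isIntegralCurveOn_forwardFlow hz).comp_add τ).mono fun r hr => ?_
  have hr : -τ ≤ r := hr
  rw [mem_vadd_set_iff_neg_vadd_mem, neg_neg, vadd_eq_add, mem_Ici]
  linarith

lemma forwardFlow_add {z : E} (hz : z ∈ closure K.Ω) {s t : ℝ} (hs : 0 ≤ s) (ht : 0 ≤ t) :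
    forwardFlow K.f (s + t) z = forwardFlow K.f s (forwardFlow K.f t z) := by
  refine K.IsForwardSolution_eq (x := fun s => forwardFlow K.f (s + t) z)
    (K.forwardFlow_mem_closure hz ht) ⟨by simp, ?_⟩ hs
  exact (K.isIntegralCurveOn_forwardFlow_add hz t).mono (Ici_subset_Ici.2 (by linarith))

/-- A Lipschitz constant of the vector field on the closed domain. -/
noncomputable def lip : NNReal :=
  (exists_lipschitzOnWith_of_isCompact K.contDiff K.isCompact_closure).choose

lemma lipschitzOnWith_lip : LipschitzOnWith K.lip K.f (closure K.Ω) :=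
  (exists_lipschitzOnWith_of_isCompact K.contDiff K.isCompact_closure).choose_spec

lemma dist_forwardFlow_le {x y : E} (hx : x ∈ closure K.Ω) (hy : y ∈ closure K.Ω) {t : ℝ}
    (ht : 0 ≤ t) :
    dist (forwardFlow K.f t x) (forwardFlow K.f t y) ≤ dist x y * Real.exp (K.lip * t) := by
  have := dist_le_exp_of_isIntegralCurveOn K.lipschitzOnWith_lip ht
    ((K.isIntegralCurveOn_forwardFlow hx).mono Icc_subset_Ici_self)
    (fun s hs => K.forwardFlow_mem_closure hx hs.1)
    ((K.isIntegralCurveOn_forwardFlow hy).mono Icc_subset_Ici_self)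
    (fun s hs => K.forwardFlow_mem_closure hy hs.1)
  simpa [K.forwardFlow_zero hx, K.forwardFlow_zero hy] using this

lemma dist_le_dist_forwardFlow {x y : E} (hx : x ∈ closure K.Ω) (hy : y ∈ closure K.Ω) {t : ℝ}
    (ht : 0 ≤ t) :
    dist x y ≤ dist (forwardFlow K.f t x) (forwardFlow K.f t y) * Real.exp (K.lip * t) := by
  have := dist_le_exp_of_isIntegralCurveOn_backward K.lipschitzOnWith_lip ht
    ((K.isIntegralCurveOn_forwardFlow hx).mono Icc_subset_Ici_self)
    (fun s hs => K.forwardFlow_mem_closure hx hs.1)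
    ((K.isIntegralCurveOn_forwardFlow hy).mono Icc_subset_Ici_self)
    (fun s hs => K.forwardFlow_mem_closure hy hs.1)
  simpa [K.forwardFlow_zero hx, K.forwardFlow_zero hy] using this

/-- If the trajectory of `x` is in the open set `Ω` before the time `τ`, then so it is at `τ`. -/
lemma forwardFlow_mem_of_forall_lt {x : E} (hx : x ∈ closure K.Ω) {τ : ℝ} (hτ : 0 < τ)
    (h : ∀ s, 0 ≤ s → s < τ → forwardFlow K.f s x ∈ K.Ω) : forwardFlow K.f τ x ∈ K.Ω := by
  set y := forwardFlow K.f τ x with hy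
  -- A local flow `α` around `y` runs backward in time. For small `s` it takes `y` back to the point
  -- of the trajectory at time `τ - s`, inside `Ω`, hence takes a neighbourhood of `y` into `Ω`.
  -- Flowing forward again puts that neighbourhood in `closure Ω`, so `y` is an interior point of
  -- the closure.
  obtain ⟨ε, hε, a, r, _, _, hr, hpl⟩ :=
    IsPicardLindelof.of_contDiffAt_one (K.contDiff.contDiffAt (x := y))
  obtain ⟨α, hα, hαc⟩ := (hpl 0).exists_forall_mem_closedBall_eq_hasDerivWithinAt_continuousOn
  simp only [zero_sub, zero_add] at hα hαc
  obtain ⟨s, hs0, hs⟩ : ∃ s, 0 < s ∧ s < min ε τ := exists_between (lt_min hε hτ)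
  have hsε : s < ε := hs.trans_le (min_le_left _ _)
  have hsτ : s < τ := hs.trans_le (min_le_right _ _)
  have hball : Metric.closedBall y r ∈ 𝓝 y := Metric.closedBall_mem_nhds _ hr
  have hcurve : ∀ z ∈ Metric.closedBall y r,
      IsIntegralCurveOn (fun t => α (z, t)) (fun _ => K.f) (Icc (-s) 0) := fun z hz t ht =>
    ((hα z hz).2 t ⟨by linarith [ht.1], by linarith [ht.2]⟩).mono
      (Icc_subset_Icc (by linarith) hε.le)
  have hback : α (y, -s) = forwardFlow K.f (τ - s) x := by
    have hc2 : IsIntegralCurveOn (fun t => forwardFlow K.f (t + τ) x) (fun _ => K.f)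
        (Icc (-s) 0) := by
      refine (K.isIntegralCurveOn_forwardFlow_add hx τ).mono fun t ht => ?_
      exact mem_Ici.2 (by linarith [ht.1])
    have := IsIntegralCurveOn.eq_left K.contDiff (by linarith)
      (hcurve y (Metric.mem_closedBall_self r.2)) hc2
      (by simpa [hy] using (hα y (Metric.mem_closedBall_self r.2)).1)
    rw [this, neg_add_eq_sub]
  have hcont : ContinuousAt (fun z => α (z, -s)) y := by
    have : ContinuousOn (fun z => α (z, -s)) (Metric.closedBall y r) :=
      hαc.comp (by fun_prop) fun z hz => ⟨hz, by linarith, by linarith⟩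
    exact this.continuousAt hball
  have hev : ∀ᶠ z in 𝓝 y, α (z, -s) ∈ K.Ω := by
    refine hcont.eventually (K.isOpen.mem_nhds ?_)
    simp only [hback]
    exact h _ (by linarith) (by linarith)
  refine K.c1Boundary.interior_closure_subset K.isOpen (mem_interior_iff_mem_nhds.2 ?_)
  filter_upwards [hev, hball] with z hz hzb
  have hzc := subset_closure hz
  have hc2 : IsIntegralCurveOn (fun t => forwardFlow K.f (t + s) (α (z, -s))) (fun _ => K.f)
      (Icc (-s) 0) := by
    refine (K.isIntegralCurveOn_forwardFlow_add hzc s).mono fun t ht => ?_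
    exact mem_Ici.2 (by linarith [ht.1])
  have := IsIntegralCurveOn.eq_right K.contDiff (by linarith) hc2 (hcurve z hzb)
    (by simp [K.forwardFlow_zero hzc])
  rw [(hα z hzb).1, zero_add] at this
  rw [← this]
  exact K.forwardFlow_mem_closure hzc hs0.le

/-- The flow leaves the open domain invariant. -/
lemma forwardFlow_mem {x : E} (hx : x ∈ K.Ω) {t : ℝ} (ht : 0 ≤ t) :
    forwardFlow K.f t x ∈ K.Ω := by
  have hxc := subset_closure hx
  by_contra hcon
  -- Exit times form a closed set; its infimum would be a first exit time, which the preceding lemma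
  -- excludes.
  set S : Set ℝ := {s | 0 ≤ s ∧ forwardFlow K.f s x ∉ K.Ω} with hS
  have hne : S.Nonempty := ⟨t, ht, hcon⟩
  have hbd : BddBelow S := ⟨0, fun s hs => hs.1⟩
  have hcl : IsClosed S :=
    (K.continuousOn_forwardFlow hxc).preimage_isClosed_of_isClosed isClosed_Ici
      K.isOpen.isClosed_compl
  have hmem := hcl.csInf_mem hne hbd
  have hpos : 0 < sInf S := by
    refine lt_of_le_of_ne hmem.1 fun h0 => hmem.2 ?_
    rw [← h0, K.forwardFlow_zero hxc]
    exact hx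
  refine hmem.2 (K.forwardFlow_mem_of_forall_lt hxc hpos fun s hs hlt => ?_)
  by_contra hcon'
  exact absurd (csInf_le hbd ⟨hs, hcon'⟩) (not_le.2 hlt)

lemma exists_bound_f : ∃ M : NNReal, ∀ x ∈ closure K.Ω, ‖K.f x‖ ≤ M := by
  obtain ⟨M, hM⟩ := K.isCompact_closure.exists_bound_of_continuousOn
    K.contDiff.continuous.continuousOn
  exact ⟨M.toNNReal, fun x hx => (hM x hx).trans (Real.le_coe_toNNReal M)⟩

/-- The speed bound makes trajectories Lipschitz in time uniformly in the starting point, which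
upgrades continuity in the starting point to joint continuity. Joint measurability, needed for
Fubini, follows. -/
lemma continuousOn_forwardFlow_uncurry :
    ContinuousOn (fun p : E × ℝ => forwardFlow K.f p.2 p.1) (closure K.Ω ×ˢ Ici 0) := by
  obtain ⟨M, hM⟩ := K.exists_bound_f
  refine continuousOn_prod_of_continuousOn_lipschitzOnWith' _ M (fun x hx => ?_) fun t ht => ?_
  · exact (convex_Ici 0).lipschitzOnWith_of_nnnorm_hasDerivWithin_le
      (K.isIntegralCurveOn_forwardFlow hx)
      fun s hs => hM _ (K.forwardFlow_mem_closure hx hs)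
  · refine LipschitzOnWith.continuousOn (K := ⟨Real.exp (K.lip * t), (Real.exp_pos _).le⟩) ?_
    refine LipschitzOnWith.of_dist_le_mul fun x hx y hy => ?_
    rw [mul_comm]
    exact K.dist_forwardFlow_le hx hy ht

open Classical in
/-- The flow, extended to a measurable map. -/
noncomputable def flow (t : ℝ) (x : E) : E :=
  if x ∈ closure K.Ω ∧ 0 ≤ t then forwardFlow K.f t x else x

lemma flow_eq {x : E} (hx : x ∈ closure K.Ω) {t : ℝ} (ht : 0 ≤ t) :
    K.flow t x = forwardFlow K.f t x := if_pos ⟨hx, ht⟩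

lemma measurable_flow_uncurry : Measurable fun p : E × ℝ => K.flow p.2 p.1 := by
  classical
  exact K.continuousOn_forwardFlow_uncurry.measurable_piecewise (g := fun p => p.1)
    continuous_fst.continuousOn (isClosed_closure.measurableSet.prod measurableSet_Ici)

lemma measurable_flow (t : ℝ) : Measurable (K.flow t) :=
  K.measurable_flow_uncurry.comp (measurable_id.prodMk measurable_const)

lemma flow_mem {x : E} (hx : x ∈ K.Ω) {t : ℝ} (ht : 0 ≤ t) : K.flow t x ∈ K.Ω := by
  rw [K.flow_eq (subset_closure hx) ht]; exact K.forwardFlow_mem hx ht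

lemma continuousOn_flow {x : E} (hx : x ∈ closure K.Ω) :
    ContinuousOn (fun t => K.flow t x) (Ici 0) :=
  (K.continuousOn_forwardFlow hx).congr fun _ ht => K.flow_eq hx ht

lemma hasDerivWithinAt_flow {x : E} (hx : x ∈ closure K.Ω) {t : ℝ} (ht : 0 ≤ t) :
    HasDerivWithinAt (fun s => K.flow s x) (K.f (K.flow t x)) (Ici 0) t := by
  rw [K.flow_eq hx ht]
  exact (K.isIntegralCurveOn_forwardFlow hx t ht).congr (fun _ hs => K.flow_eq hx hs)
    (K.flow_eq hx ht)

lemma flow_zero {x : E} (hx : x ∈ closure K.Ω) : K.flow 0 x = x := by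
  rw [K.flow_eq hx le_rfl, K.forwardFlow_zero hx]

lemma flow_add {x : E} (hx : x ∈ K.Ω) {s t : ℝ} (hs : 0 ≤ s) (ht : 0 ≤ t) :
    K.flow (s + t) x = K.flow s (K.flow t x) := by
  rw [K.flow_eq (subset_closure hx) (add_nonneg hs ht),
    K.flow_eq (subset_closure (K.flow_mem hx ht)) hs, K.flow_eq (subset_closure hx) ht,
    K.forwardFlow_add (subset_closure hx) hs ht]

end KoopmanSystem

/-! ## Volume of preimages under maps with Lipschitz inverse -/

/-- An expansion bound on `Φ` bounds the volume of a set by that of its image. -/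
lemma volume_le_of_dist_le {d : ℕ} {Φ : EuclideanSpace ℝ (Fin d) → EuclideanSpace ℝ (Fin d)}
    {S : Set (EuclideanSpace ℝ (Fin d))} {c : NNReal}
    (h : ∀ x ∈ S, ∀ y ∈ S, dist x y ≤ c * dist (Φ x) (Φ y)) :
    volume S ≤ (c : ℝ≥0∞) ^ d * volume (Φ '' S) := by
  -- Lebesgue measure is a multiple of `d`-dimensional Hausdorff measure, whose bound for Lipschitz
  -- images applies to the inverse of `Φ` on `Φ '' S`. No differentiability of the flow is required.
  obtain ⟨a, ha⟩ : ∃ a : NNReal, (volume : Measure (EuclideanSpace ℝ (Fin d))) =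
      a • Measure.hausdorffMeasure (Module.finrank ℝ (EuclideanSpace ℝ (Fin d))) :=
    ⟨_, Measure.isAddLeftInvariant_eq_smul _ _⟩
  have hinj : InjOn Φ S := fun x hx y hy hxy => by
    have := h x hx y hy
    rwa [hxy, dist_self, mul_zero, dist_le_zero] at this
  have hlip : LipschitzOnWith c (Function.invFunOn Φ S) (Φ '' S) := by
    refine LipschitzOnWith.of_dist_le_mul ?_
    rintro _ ⟨x, hx, rfl⟩ _ ⟨y, hy, rfl⟩
    rw [hinj.leftInvOn_invFunOn hx, hinj.leftInvOn_invFunOn hy]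
    exact h x hx y hy
  have := hlip.hausdorffMeasure_image_le
    (d := (Module.finrank ℝ (EuclideanSpace ℝ (Fin d)) : ℝ)) (by positivity)
  rw [hinj.leftInvOn_invFunOn.image_image, ENNReal.rpow_natCast, finrank_euclideanSpace_fin]
    at this
  rw [finrank_euclideanSpace_fin] at ha
  rw [ha, Measure.smul_apply, Measure.smul_apply, ENNReal.smul_def, ENNReal.smul_def, smul_eq_mul,
    smul_eq_mul, mul_left_comm]
  gcongr

/-! ## Mollification of functions with a weak gradient -/

section Mollify

variable {V : Type*} [NormedAddCommGroup V] [NormedSpace ℝ V] [FiniteDimensional ℝ V]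
  [MeasurableSpace V] [BorelSpace V] (μ : Measure V) [μ.IsAddHaarMeasure]
  {F : Type*} [NormedAddCommGroup F] [NormedSpace ℝ F]

/-- Mollification by a bump function. -/
noncomputable def mollify (φ : ContDiffBump (0 : V)) (u : V → F) : V → F :=
  convolution (φ.normed μ) u (ContinuousLinearMap.lsmul ℝ ℝ) μ

variable {μ}

lemma norm_mollify_le [CompleteSpace F] (φ : ContDiffBump (0 : V)) {u : V → F} {C : ℝ}
    (hC : ∀ᵐ x ∂μ, ‖u x‖ ≤ C) (x : V) : ‖mollify μ φ u x‖ ≤ C := by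
  have h1 : ∫ y, φ.normed μ (x - y) * C ∂μ = C := by
    rw [integral_mul_const, integral_sub_left_eq_self (φ.normed μ), φ.integral_normed, one_mul]
  rw [mollify, convolution_lsmul_swap]
  refine (norm_integral_le_of_norm_le ?_ ?_).trans_eq h1
  · exact (φ.integrable_normed.comp_sub_left x).mul_const C
  · filter_upwards [hC] with y hy
    rw [norm_smul, Real.norm_of_nonneg (φ.nonneg_normed _)]
    exact mul_le_mul_of_nonneg_left hy (φ.nonneg_normed _)

lemma continuous_mollify (φ : ContDiffBump (0 : V)) {u : V → F} (hu : LocallyIntegrable u μ) :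
    Continuous (mollify μ φ u) :=
  φ.hasCompactSupport_normed.continuous_convolution_left _ φ.continuous_normed hu

end Mollify

/-- The derivative falls on the bump, and `y ↦ ρ (x - y)` is an admissible test function once the
ball lies in `Ω`, so the weak gradient takes over. The jump of the zero extension across the
boundary is then invisible. -/
lemma hasFDerivAt_mollify {d : ℕ} {Ω : Set (EuclideanSpace ℝ (Fin d))} (hΩ : MeasurableSet Ω)
    {u : EuclideanSpace ℝ (Fin d) → ℝ}
    {G : EuclideanSpace ℝ (Fin d) → EuclideanSpace ℝ (Fin d)} (h : HasWeakGradient Ω u G)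
    (hu : LocallyIntegrable (Ω.indicator u))
    (φ : ContDiffBump (0 : EuclideanSpace ℝ (Fin d))) {x : EuclideanSpace ℝ (Fin d)}
    (hx : Metric.closedBall x φ.rOut ⊆ Ω) :
    HasFDerivAt (mollify volume φ (Ω.indicator u))
      (innerSL ℝ (mollify volume φ (Ω.indicator G) x)) x := by
  set ρ := φ.normed volume with hρ
  have hρs : ContDiff ℝ ((⊤ : ℕ∞) : WithTop ℕ∞) ρ := φ.contDiff_normed
  have hρ1 : ContDiff ℝ 1 ρ := hρs.of_le (by exact_mod_cast le_top)
  have hρc : HasCompactSupport ρ := φ.hasCompactSupport_normed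
  have key := hρc.hasFDerivAt_convolution_left (ContinuousLinearMap.lsmul ℝ ℝ) hρ1 hu x
  refine key.congr_fderiv ?_
  ext v
  set η : EuclideanSpace ℝ (Fin d) → ℝ := fun y => ρ (x - y) with hη
  have hgrad : ∀ y, HasFDerivAt η (-(fderiv ℝ ρ (x - y))) y := by
    intro y
    have h1 := (hρ1.differentiable one_ne_zero (x - y)).hasFDerivAt
    have h2 := h1.comp y ((hasFDerivAt_id y).const_sub x)
    refine h2.congr_fderiv ?_
    ext w; simp
  have hsupp : tsupport η ⊆ Metric.closedBall x φ.rOut := by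
    refine closure_minimal (fun y hy => ?_) Metric.isClosed_closedBall
    have : x - y ∈ tsupport ρ := subset_tsupport _ hy
    rw [hρ, φ.tsupport_normed_eq, mem_closedBall_zero_iff, ← dist_eq_norm] at this
    rwa [Metric.mem_closedBall, dist_comm]
  have hηc : HasCompactSupport η :=
    (isCompact_closedBall x φ.rOut).of_isClosed_subset (isClosed_tsupport _) hsupp
  have hη1 : ContDiff ℝ ((⊤ : ℕ∞) : WithTop ℕ∞) η := hρs.comp (contDiff_const.sub contDiff_id)
  have hw := h.2.2 η hη1 hηc (hsupp.trans hx)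
  have e1 : ∫ y in Ω, η y • G y = mollify volume φ (Ω.indicator G) x := by
    rw [mollify, convolution_lsmul_swap, ← integral_indicator hΩ]
    refine integral_congr_ae (Eventually.of_forall fun y => ?_)
    by_cases hy : y ∈ Ω <;> simp [hy, hη, hρ]
  have hint : ConvolutionExistsAt (fderiv ℝ ρ) (Ω.indicator u) x
      ((ContinuousLinearMap.lsmul ℝ ℝ).precompL (EuclideanSpace ℝ (Fin d))) volume :=
    (hρc.fderiv ℝ).convolutionExists_left _ (hρ1.continuous_fderiv one_ne_zero) hu x
  have hint' := hint.integrable_swap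
  rw [convolution_eq_swap, ContinuousLinearMap.integral_apply hint']
  rw [innerSL_apply_apply, ← e1]
  have hw' : ∫ y in Ω, η y • G y = ∫ y in Ω, u y • -gradient η y := by
    simp only [smul_neg, integral_neg, hw, neg_neg]
  have hgc : Continuous (gradient η) := by
    have hfc : Continuous (fderiv ℝ η) := hη1.continuous_fderiv (by simp)
    exact (InnerProductSpace.toDual ℝ (EuclideanSpace ℝ (Fin d))).symm.continuous.comp hfc
  have hgs : HasCompactSupport (gradient η) :=
    (hηc.fderiv ℝ).comp_left (map_zero _)
  have hint2 : IntegrableOn (fun y => u y • -gradient η y) Ω := by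
    rw [← integrable_indicator_iff hΩ]
    have : Integrable (fun y => Ω.indicator u y • -gradient η y) :=
      hu.integrable_smul_right_of_hasCompactSupport hgc.neg hgs.neg
    refine this.congr (Eventually.of_forall fun y => ?_)
    by_cases hy : y ∈ Ω <;> simp [hy]
  rw [hw', real_inner_comm, ← integral_inner hint2, ← integral_indicator hΩ]
  refine integral_congr_ae (Eventually.of_forall fun y => ?_)
  by_cases hy : y ∈ Ω
  · simp [hy, inner_smul_right, (hgrad y).fderiv, ContinuousLinearMap.precompL_apply, mul_comm]
  · simp [hy]

/-! ## Uniqueness of the weak gradient -/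

lemma integrable_smul_of_tsupport_subset {V F : Type*} [NormedAddCommGroup V]
    [MeasurableSpace V] [BorelSpace V] {μ : Measure V} [NormedAddCommGroup F] [NormedSpace ℝ F]
    {Ω : Set V} {G : V → F} (hG : LocallyIntegrableOn G Ω μ)
    {η : V → ℝ} (hη : Continuous η) (hηc : HasCompactSupport η) (hηs : tsupport η ⊆ Ω) :
    Integrable (fun x => η x • G x) μ := by
  rw [← integrableOn_iff_integrable_of_support_subset (s := tsupport η)]
  · exact (hG.integrableOn_compact_subset hηs hηc).continuousOn_smul hη.continuousOn hηc
  · exact (Function.support_smul_subset_left _ _).trans (subset_tsupport η)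

/-- `weakGradient` is an arbitrary choice; this transfers to it the essential bound known for some
weak gradient. The reason is the fundamental lemma of the calculus of variations. -/
lemma HasWeakGradient.ae_eq {d : ℕ} {Ω : Set (EuclideanSpace ℝ (Fin d))} (hΩ : IsOpen Ω)
    {u : EuclideanSpace ℝ (Fin d) → ℝ}
    {G G' : EuclideanSpace ℝ (Fin d) → EuclideanSpace ℝ (Fin d)} (h : HasWeakGradient Ω u G)
    (h' : HasWeakGradient Ω u G') : G =ᵐ[volume.restrict Ω] G' := by
  have := hΩ.ae_eq_zero_of_integral_contDiff_smul_eq_zero (μ := volume) (h.2.1.sub h'.2.1) ?_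
  · rw [Filter.EventuallyEq, ae_restrict_iff' hΩ.measurableSet]
    filter_upwards [this] with x hx hxΩ
    exact sub_eq_zero.1 (hx hxΩ)
  · intro η hη hηc hηs
    have i1 := integrable_smul_of_tsupport_subset h.2.1 hη.continuous hηc hηs
    have i2 := integrable_smul_of_tsupport_subset h'.2.1 hη.continuous hηc hηs
    have hz : ∀ x, x ∉ Ω → η x = 0 := fun x hx =>
      image_eq_zero_of_notMem_tsupport fun hx' => hx (hηs hx')
    have e1 : ∫ x in Ω, η x • G x = ∫ x, η x • G x :=
      setIntegral_eq_integral_of_forall_compl_eq_zero fun x hx => by rw [hz x hx, zero_smul]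
    have e2 : ∫ x in Ω, η x • G' x = ∫ x, η x • G' x :=
      setIntegral_eq_integral_of_forall_compl_eq_zero fun x hx => by rw [hz x hx, zero_smul]
    have := (h.2.2 η hη hηc hηs).symm.trans (h'.2.2 η hη hηc hηs)
    simp only [Pi.sub_apply, smul_sub]
    rw [integral_sub i1 i2, ← e1, ← e2, sub_eq_zero]
    exact neg_injective this

namespace KoopmanSystem

variable {d : ℕ} (K : KoopmanSystem d)

local notation "E" => EuclideanSpace ℝ (Fin d)

/-! ## The flow and Lebesgue measure -/

lemma ae_mem : ∀ᵐ x ∂K.vol, x ∈ K.Ω := ae_restrict_mem K.isOpen.measurableSet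

/-- The factor by which the flow may compress volumes. -/
noncomputable def compression (t : ℝ) : ℝ≥0∞ := ENNReal.ofReal (Real.exp (d * K.lip * t))

/-- By backward Gronwall the inverse of the flow is Lipschitz with constant `exp (L t)`, so
preimages have volume at most `exp (d L t)` times larger. -/
lemma map_flow_le {t : ℝ} (ht : 0 ≤ t) : K.vol.map (K.flow t) ≤ K.compression t • K.vol := by
  refine Measure.le_iff.2 fun A hA => ?_
  rw [Measure.map_apply (K.measurable_flow t) hA, Measure.smul_apply, smul_eq_mul,
    Measure.restrict_apply (K.measurable_flow t hA), Measure.restrict_apply hA]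
  have h1 := volume_le_of_dist_le (Φ := K.flow t) (S := K.flow t ⁻¹' A ∩ K.Ω)
    (c := Real.toNNReal (Real.exp (K.lip * t))) (fun x hx y hy => by
      rw [Real.coe_toNNReal _ (Real.exp_pos _).le, mul_comm, K.flow_eq (subset_closure hx.2) ht,
        K.flow_eq (subset_closure hy.2) ht]
      exact K.dist_le_dist_forwardFlow (subset_closure hx.2) (subset_closure hy.2) ht)
  refine h1.trans (mul_le_mul' (le_of_eq ?_) (measure_mono ?_))
  · rw [compression, ← ENNReal.ofReal, ← ENNReal.ofReal_pow (Real.exp_pos _).le, ← Real.exp_nat_mul,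
      mul_assoc]
  · rintro _ ⟨x, hx, rfl⟩
    exact ⟨hx.1, K.flow_mem hx.2 ht⟩

lemma quasiMeasurePreserving_flow {t : ℝ} (ht : 0 ≤ t) :
    Measure.QuasiMeasurePreserving (K.flow t) K.vol K.vol :=
  ⟨K.measurable_flow t,
    (Measure.absolutelyContinuous_of_le (K.map_flow_le ht)).trans
      (Measure.smul_absolutelyContinuous)⟩

lemma ae_flow {p : E → Prop} (hp : ∀ᵐ x ∂K.vol, p x) {t : ℝ} (ht : 0 ≤ t) :
    ∀ᵐ x ∂K.vol, p (K.flow t x) := (K.quasiMeasurePreserving_flow ht).ae hp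

/-- Fubini: a property that holds almost everywhere holds at almost every time along almost every
trajectory. The exceptional set is enlarged to a measurable null set so that its preimage in
space-time is measurable. -/
lemma ae_ae_flow {p : E → Prop} (hp : ∀ᵐ x ∂K.vol, p x) (t : ℝ) :
    ∀ᵐ x ∂K.vol, ∀ᵐ s ∂volume.restrict (Ioc 0 t), p (K.flow s x) := by
  have := K.isFiniteMeasure_vol
  set N := toMeasurable K.vol {x | ¬ p x} with hN
  have hN0 : ∀ᵐ x ∂K.vol, x ∉ N := by
    rw [ae_iff]
    simp only [not_not]
    exact (measure_toMeasurable {x | ¬ p x}).trans (ae_iff.1 hp)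
  have hm : MeasurableSet {q : E × ℝ | K.flow q.2 q.1 ∉ N} :=
    K.measurable_flow_uncurry (measurableSet_toMeasurable _ _).compl
  have h1 : ∀ᵐ x ∂K.vol, ∀ᵐ s ∂volume.restrict (Ioc 0 t), K.flow s x ∉ N := by
    refine (Measure.ae_ae_comm (p := fun x s => K.flow s x ∉ N) hm).2 ?_
    filter_upwards [ae_restrict_mem measurableSet_Ioc] with s hs
    exact K.ae_flow hN0 hs.1.le
  filter_upwards [h1] with x hx
  filter_upwards [hx] with s hs
  by_contra hcon
  exact hs (subset_toMeasurable _ _ hcon)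

/-! ## The reciprocal weight along the flow -/

/-- The reciprocal weight. -/
noncomputable def u (x : E) : ℝ := (K.w x)⁻¹

/-- The weak gradient of the reciprocal weight. -/
noncomputable def gradU : E → E := weakGradient K.Ω K.u

lemma measurable_u : Measurable K.u := K.measurable_w.inv

lemma u_pos : ∀ᵐ x ∂K.vol, 0 < K.u x := by
  filter_upwards [K.w_pos] with x hx using inv_pos.2 hx

lemma hasWeakGradient_u : HasWeakGradient K.Ω K.u K.gradU := by
  have h : ∃ G, HasWeakGradient K.Ω K.u G := K.inv_w_sobolev.2.imp fun _ hG => hG.1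
  rw [gradU, weakGradient, dif_pos h]
  exact h.choose_spec

lemma memLp_gradU : MemLp K.gradU ∞ K.vol := by
  obtain ⟨-, G, hG, hGL⟩ := K.inv_w_sobolev
  exact hGL.ae_eq (hG.ae_eq K.isOpen K.hasWeakGradient_u)

lemma exists_ae_bound {F : Type*} [NormedAddCommGroup F] {v : E → F} (h : MemLp v ∞ K.vol) :
    ∃ C : ℝ, 0 ≤ C ∧ ∀ᵐ x ∂K.vol, ‖v x‖ ≤ C := by
  refine ⟨(eLpNorm v ∞ K.vol).toReal, ENNReal.toReal_nonneg, ?_⟩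
  have h2 := h.2
  rw [eLpNorm_exponent_top] at h2 ⊢
  filter_upwards [ae_le_eLpNormEssSup (f := v) (μ := K.vol)] with x hx
  rw [← toReal_enorm]
  exact ENNReal.toReal_mono h2.ne hx

lemma ae_norm_indicator_le {F : Type*} [NormedAddCommGroup F] {v : E → F} {C : ℝ} (hC : 0 ≤ C)
    (h : ∀ᵐ x ∂K.vol, ‖v x‖ ≤ C) : ∀ᵐ x, ‖K.Ω.indicator v x‖ ≤ C := by
  rw [ae_restrict_iff' K.isOpen.measurableSet] at h
  filter_upwards [h] with x hx
  by_cases hxΩ : x ∈ K.Ω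
  · rw [indicator_of_mem hxΩ]; exact hx hxΩ
  · simpa [indicator_of_notMem hxΩ]

lemma integrable_indicator_of_memLp_top {F : Type*} [NormedAddCommGroup F] {v : E → F}
    (h : MemLp v ∞ K.vol) : Integrable (K.Ω.indicator v) := by
  have := K.isFiniteMeasure_vol
  rw [integrable_indicator_iff K.isOpen.measurableSet]
  exact (h.mono_exponent (p := 1) le_top).integrable le_rfl

/-- A shrinking sequence of bump functions. -/
noncomputable def bump (n : ℕ) : ContDiffBump (0 : E) where
  rIn := 1 / (n + 1)
  rOut := 2 / (n + 1)
  rIn_pos := by positivity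
  rIn_lt_rOut := by gcongr; norm_num

lemma tendsto_bump_rOut : Tendsto (fun n => (bump (d := d) n).rOut) atTop (𝓝 0) := by
  have := (tendsto_one_div_add_atTop_nhds_zero_nat (𝕜 := ℝ)).const_mul 2
  rw [mul_zero] at this
  refine this.congr fun n => ?_
  simp [bump, div_eq_mul_inv]

lemma ae_tendsto_mollify {F : Type*} [NormedAddCommGroup F] [NormedSpace ℝ F] [CompleteSpace F]
    {v : E → F} (h : MemLp v ∞ K.vol) :
    ∀ᵐ x ∂K.vol, Tendsto (fun n => mollify volume (bump n) (K.Ω.indicator v) x) atTop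
      (𝓝 (v x)) := by
  rw [ae_restrict_iff' K.isOpen.measurableSet]
  have := ContDiffBump.ae_convolution_tendsto_right_of_locallyIntegrable (μ := volume)
    (φ := bump (d := d)) (K := 2) tendsto_bump_rOut
    (Eventually.of_forall fun n => by simp [bump, div_eq_mul_inv])
    (K.integrable_indicator_of_memLp_top h).locallyIntegrable
  filter_upwards [this] with x hx hxΩ
  rw [indicator_of_mem hxΩ] at hx
  exact hx

lemma hasDerivWithinAt_mollify_flow {x : E} (hx : x ∈ closure K.Ω) {s : ℝ} (hs : 0 ≤ s) (l : ℝ)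
    (φ : ContDiffBump (0 : E)) (hb : Metric.closedBall (K.flow s x) φ.rOut ⊆ K.Ω) :
    HasDerivWithinAt
      (fun r => Real.exp (-l * r) * mollify volume φ (K.Ω.indicator K.u) (K.flow r x))
      (Real.exp (-l * s) * (inner ℝ (mollify volume φ (K.Ω.indicator K.gradU) (K.flow s x))
        (K.f (K.flow s x)) - l * mollify volume φ (K.Ω.indicator K.u) (K.flow s x)))
      (Ioi s) s := by
  have h1 := hasFDerivAt_mollify K.isOpen.measurableSet K.hasWeakGradient_u
    (K.integrable_indicator_of_memLp_top K.inv_w_sobolev.1).locallyIntegrable φ hb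
  have h2 : HasDerivWithinAt (fun r => K.flow r x) (K.f (K.flow s x)) (Ioi s) s :=
    (K.hasDerivWithinAt_flow hx hs).mono fun r hr => hs.trans (le_of_lt hr)
  have h3 := h1.comp_hasDerivWithinAt s h2
  have h4 : HasDerivWithinAt (fun r : ℝ => Real.exp (-l * r)) (Real.exp (-l * s) * -l)
      (Ioi s) s := by
    have := ((hasDerivAt_id s).const_mul (-l)).exp
    simpa using this.hasDerivWithinAt
  refine (h4.mul h3).congr_deriv ?_
  simp only [innerSL_apply_apply, Function.comp]
  ring

/-- The fundamental theorem of calculus for the reciprocal weight along trajectories. -/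
lemma ae_flow_formula {t : ℝ} (ht : 0 ≤ t) (l : ℝ) :
    ∀ᵐ x ∂K.vol, Real.exp (-l * t) * K.u (K.flow t x) - K.u x =
      ∫ s in (0 : ℝ)..t, Real.exp (-l * s) *
        (inner ℝ (K.gradU (K.flow s x)) (K.f (K.flow s x)) - l * K.u (K.flow s x)) := by
  have hu : MemLp K.u ∞ K.vol := K.inv_w_sobolev.1
  have hG := K.memLp_gradU
  obtain ⟨Cu, hCu0, hCu⟩ := K.exists_ae_bound hu
  obtain ⟨CG, hCG0, hCG⟩ := K.exists_ae_bound hG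
  obtain ⟨M, hM⟩ := K.exists_bound_f
  have hP := (K.ae_tendsto_mollify hu).and (K.ae_tendsto_mollify hG)
  have hui := (K.integrable_indicator_of_memLp_top hu).locallyIntegrable
  have hGi := (K.integrable_indicator_of_memLp_top hG).locallyIntegrable
  filter_upwards [K.ae_mem, hP, K.ae_flow hP ht, K.ae_ae_flow hP t] with x hxΩ hx hxt hxs
  have hxc := subset_closure hxΩ
  obtain ⟨un, hun⟩ : ∃ un : ℕ → E → ℝ, un = fun n => mollify volume (bump n) (K.Ω.indicator K.u) :=
    ⟨_, rfl⟩
  obtain ⟨Gn, hGn⟩ : ∃ Gn : ℕ → E → E, Gn = fun n => mollify volume (bump n) (K.Ω.indicator K.gradU) :=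
    ⟨_, rfl⟩
  have hunb : ∀ n y, ‖un n y‖ ≤ Cu := fun n y => hun ▸
    norm_mollify_le _ (K.ae_norm_indicator_le hCu0 hCu) y
  have hGnb : ∀ n y, ‖Gn n y‖ ≤ CG := fun n y => hGn ▸
    norm_mollify_le _ (K.ae_norm_indicator_le hCG0 hCG) y
  have hunc : ∀ n, Continuous (un n) := fun n => hun ▸ continuous_mollify _ hui
  have hGnc : ∀ n, Continuous (Gn n) := fun n => hGn ▸ continuous_mollify _ hGi
  have hfl : ContinuousOn (fun s => K.flow s x) (Icc 0 t) :=
    (K.continuousOn_flow hxc).mono Icc_subset_Ici_self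
  set F : ℕ → ℝ → ℝ := fun n s => Real.exp (-l * s) *
    (inner ℝ (Gn n (K.flow s x)) (K.f (K.flow s x)) - l * un n (K.flow s x)) with hF
  have hFc : ∀ n, ContinuousOn (F n) (Icc 0 t) := fun n => by
    refine ContinuousOn.mul (by fun_prop) (ContinuousOn.sub (ContinuousOn.inner (𝕜 := ℝ) ?_ ?_) ?_)
    · exact (hGnc n).comp_continuousOn hfl
    · exact K.contDiff.continuous.comp_continuousOn hfl
    · exact continuousOn_const.mul ((hunc n).comp_continuousOn hfl)
  -- The trajectory on `[0, t]` is a compact subset of `Ω`, so one radius `δ` works along all of it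
  -- and the mollified identity holds once the bump is narrower than `δ`.
  obtain ⟨δ, hδ, hδΩ⟩ := (isCompact_Icc.image_of_continuousOn hfl).exists_cthickening_subset_open
    K.isOpen (by rintro _ ⟨s, hs, rfl⟩; exact K.flow_mem hxΩ hs.1)
  have hev : ∀ᶠ n in atTop, Real.exp (-l * t) * un n (K.flow t x) - un n x =
      ∫ s in (0 : ℝ)..t, F n s := by
    filter_upwards [tendsto_bump_rOut.eventually_lt_const hδ] with n hn
    have := intervalIntegral.integral_eq_sub_of_hasDeriv_right_of_le ht
      (f := fun s => Real.exp (-l * s) * un n (K.flow s x)) (f' := F n) ?_ ?_ ?_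
    · rw [this, K.flow_zero hxc]; simp
    · exact ContinuousOn.mul (by fun_prop) ((hunc n).comp_continuousOn hfl)
    · intro s hs
      have hmem : K.flow s x ∈ (fun s => K.flow s x) '' Icc 0 t :=
        ⟨s, Ioo_subset_Icc_self hs, rfl⟩
      have hb : Metric.closedBall (K.flow s x) (bump (d := d) n).rOut ⊆ K.Ω :=
        (Metric.closedBall_subset_closedBall hn.le).trans
          ((Metric.closedBall_subset_cthickening hmem δ).trans hδΩ)
      simp only [hF, hun, hGn]
      exact K.hasDerivWithinAt_mollify_flow hxc hs.1.le l (bump n) hb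
    · exact (by rw [uIcc_of_le ht]; exact hFc n : ContinuousOn (F n) (uIcc 0 t)).intervalIntegrable
  have hl1 : Tendsto (fun n => Real.exp (-l * t) * un n (K.flow t x) - un n x) atTop
      (𝓝 (Real.exp (-l * t) * K.u (K.flow t x) - K.u x)) :=
    hun ▸ (hxt.1.const_mul _).sub hx.1
  have hl2 : Tendsto (fun n => ∫ s in (0 : ℝ)..t, F n s) atTop
      (𝓝 (∫ s in (0 : ℝ)..t, Real.exp (-l * s) *
        (inner ℝ (K.gradU (K.flow s x)) (K.f (K.flow s x)) - l * K.u (K.flow s x)))) := by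
    refine intervalIntegral.tendsto_integral_filter_of_dominated_convergence
      (fun s => Real.exp (-l * s) * (CG * M + |l| * Cu)) ?_ ?_ ?_ ?_
    · refine Eventually.of_forall fun n => ?_
      rw [uIoc_of_le ht]
      exact ((hFc n).mono Ioc_subset_Icc_self).aestronglyMeasurable measurableSet_Ioc
    · refine Eventually.of_forall fun n => Eventually.of_forall fun s hs => ?_
      rw [uIoc_of_le ht] at hs
      rw [hF, norm_mul, Real.norm_of_nonneg (Real.exp_pos _).le]
      refine mul_le_mul_of_nonneg_left ((norm_sub_le _ _).trans (add_le_add ?_ ?_))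
        (Real.exp_pos _).le
      · refine (norm_inner_le_norm _ _).trans (mul_le_mul (hGnb n _) (hM _ ?_) (norm_nonneg _) hCG0)
        exact subset_closure (K.flow_mem hxΩ hs.1.le)
      · rw [norm_mul]
        exact mul_le_mul_of_nonneg_left (hunb n _) (norm_nonneg _)
    · exact Continuous.intervalIntegrable (by fun_prop) _ _
    · rw [uIoc_of_le ht, ← ae_restrict_iff' measurableSet_Ioc]
      filter_upwards [hxs] with s hs
      simp only [hF, hun, hGn]
      exact ((hs.2.inner tendsto_const_nhds).sub (hs.1.const_mul l)).const_mul _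
  exact tendsto_nhds_unique (hl1.congr' hev) hl2

/-- With `l = max ω₀ 0` the integrand in `ae_flow_formula` is nonpositive. Truncating at `0` gives a
nonnegative rate, which simplifies bounds on `[0, 1]`. -/
lemma exists_growth : ∃ κ : ℝ, 0 ≤ κ ∧ ∀ t, 0 ≤ t → ∀ᵐ x ∂K.vol,
    K.u (K.flow t x) ≤ Real.exp (κ * t) * K.u x := by
  obtain ⟨ω₀, hω⟩ := K.dissipative
  refine ⟨max ω₀ 0, le_max_right _ _, fun t ht => ?_⟩
  have hp : ∀ᵐ x ∂K.vol, inner ℝ (K.gradU x) (K.f x) - max ω₀ 0 * K.u x ≤ 0 := by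
    filter_upwards [hω, K.w_pos] with x hx hw
    -- Since `∇w = -w² ∇u`, the quotient `-f · ∇w / w` equals `w f · ∇u`.
    have e : -(inner ℝ (K.f x) (-(K.w x ^ 2) • weakGradient K.Ω (fun y => (K.w y)⁻¹) x) / K.w x)
        = K.w x * inner ℝ (K.gradU x) (K.f x) := by
      rw [inner_smul_right, real_inner_comm]
      change _ = K.w x * inner ℝ (weakGradient K.Ω (fun y => (K.w y)⁻¹) x) (K.f x)
      field_simp
    rw [e] at hx
    have h2 : K.w x * inner ℝ (K.gradU x) (K.f x) ≤ max ω₀ 0 := hx.trans (le_max_left _ _)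
    rw [sub_nonpos, u, ← div_eq_mul_inv, le_div_iff₀ hw, mul_comm]
    exact h2
  filter_upwards [K.ae_flow_formula ht (max ω₀ 0), K.ae_ae_flow hp t] with x hx hx2
  have hneg : ∫ s in (0 : ℝ)..t, Real.exp (-(max ω₀ 0) * s) *
      (inner ℝ (K.gradU (K.flow s x)) (K.f (K.flow s x)) - max ω₀ 0 * K.u (K.flow s x)) ≤ 0 := by
    rw [intervalIntegral.integral_of_le ht]
    refine integral_nonpos_of_ae ?_
    filter_upwards [hx2] with s hs
    exact mul_nonpos_of_nonneg_of_nonpos (Real.exp_pos _).le hs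
  rw [← hx, sub_nonpos, neg_mul, Real.exp_neg, inv_mul_le_iff₀ (Real.exp_pos _)] at hneg
  exact hneg

lemma exists_modulus : ∃ C : ℝ, ∀ t, 0 ≤ t → ∀ᵐ x ∂K.vol,
    |K.u (K.flow t x) - K.u x| ≤ C * t := by
  obtain ⟨CG, hCG0, hCG⟩ := K.exists_ae_bound K.memLp_gradU
  obtain ⟨M, hM⟩ := K.exists_bound_f
  refine ⟨CG * M, fun t ht => ?_⟩
  filter_upwards [K.ae_flow_formula ht 0, K.ae_ae_flow hCG t, K.ae_mem] with x hx hx2 hxΩ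
  simp only [neg_zero, zero_mul, Real.exp_zero, one_mul, sub_zero] at hx
  rw [hx, ← Real.norm_eq_abs]
  have := intervalIntegral.norm_integral_le_of_norm_le_const_ae (a := 0) (b := t) (C := CG * M)
    (f := fun s => inner ℝ (K.gradU (K.flow s x)) (K.f (K.flow s x))) ?_
  · rwa [sub_zero, abs_of_nonneg ht] at this
  · rw [uIoc_of_le ht, ← ae_restrict_iff' measurableSet_Ioc]
    filter_upwards [hx2, ae_restrict_mem measurableSet_Ioc] with s hs hs0
    refine (norm_inner_le_norm _ _).trans (mul_le_mul hs (hM _ ?_) (norm_nonneg _) hCG0)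
    exact subset_closure (K.flow_mem hxΩ hs0.1.le)

/-! ## The pairing and the dual of `X` -/

lemma μH_ac_vol : K.μH ≪ K.vol := withDensity_absolutelyContinuous _ _

lemma aestronglyMeasurable_mul_w {ψ : E → ℝ} (h : AEStronglyMeasurable ψ K.vol) :
    AEStronglyMeasurable (fun x => ψ x * K.w x) K.vol :=
  h.mul K.measurable_w.aestronglyMeasurable

lemma aestronglyMeasurable_of_mul_w {ψ : E → ℝ}
    (h : AEStronglyMeasurable (fun x => ψ x * K.w x) K.vol) : AEStronglyMeasurable ψ K.vol := by
  refine (h.mul K.measurable_u.aestronglyMeasurable).congr ?_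
  filter_upwards [K.w_pos] with x hx
  simp only [Pi.mul_apply, u]
  field_simp

lemma memLp_two_μH_iff {ψ : E → ℝ} :
    MemLp ψ 2 K.μH ↔ MemLp (fun x => ψ x * K.w x) 2 K.vol := by
  constructor
  · rintro ⟨h1, h2⟩
    exact ⟨K.aestronglyMeasurable_mul_w (h1.mono_ac K.vol_ac_μH), K.eLpNorm_two_μH ψ ▸ h2⟩
  · rintro ⟨h1, h2⟩
    exact ⟨(K.aestronglyMeasurable_of_mul_w h1).mono_ac K.μH_ac_vol, (K.eLpNorm_two_μH ψ).symm ▸ h2⟩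

lemma MemDual.memLp {K : KoopmanSystem d} {ψ : E → ℝ} (h : K.MemDual ψ) : MemLp ψ 2 K.μH := by
  have := K.isFiniteMeasure_vol
  exact K.memLp_two_μH_iff.2 (h.mono_exponent le_top)

lemma memDual_of_ae_le {ψ : E → ℝ} (h : AEStronglyMeasurable ψ K.vol) {C : ℝ}
    (hC : ∀ᵐ x ∂K.vol, ‖ψ x * K.w x‖ ≤ C) : K.MemDual ψ :=
  memLp_top_of_bound (K.aestronglyMeasurable_mul_w h) C hC

lemma dualNorm_le_of_ae_le {ψ : E → ℝ} {C : ℝ} (hC0 : 0 ≤ C)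
    (hC : ∀ᵐ x ∂K.vol, ‖ψ x * K.w x‖ ≤ C) : K.dualNorm ψ ≤ C := by
  rw [dualNorm, eLpNorm_exponent_top]
  refine ENNReal.toReal_le_of_le_ofReal hC0 (eLpNormEssSup_le_of_ae_bound hC)

lemma pairing_congr {φ φ' ψ ψ' : E → ℝ} (h : φ =ᵐ[K.vol] φ') (h' : ψ =ᵐ[K.vol] ψ') :
    K.pairing φ ψ = K.pairing φ' ψ' := by
  refine integral_congr_ae ?_
  filter_upwards [h, h'] with x hx hx'
  rw [hx, hx']

lemma embed_ae_eq (φ : K.H) : K.embed φ =ᵐ[K.vol] φ :=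
  K.vol_ac_μX.ae_le (K.memLp_embed φ).coeFn_toLp

lemma toLp_ae_eq {ψ : E → ℝ} (h : MemLp ψ 2 K.μH) : h.toLp ψ =ᵐ[K.vol] ψ :=
  K.vol_ac_μH.ae_le h.coeFn_toLp

lemma inner_eq_pairing (φ ψ : K.H) : inner ℝ φ ψ = K.pairing φ ψ := by
  rw [L2.inner_def]
  refine (integral_withDensity_eq_integral_toReal_smul (K.measurable_w.pow_const 2).ennreal_ofReal
    (Eventually.of_forall fun _ => ENNReal.ofReal_lt_top) _).trans ?_
  refine integral_congr_ae (Eventually.of_forall fun x => ?_)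
  simp only [ENNReal.toReal_ofReal (sq_nonneg _), smul_eq_mul, RCLike.inner_apply,
    conj_trivial]
  ring

lemma exists_norming (φ : K.X) :
    ∃ ψ : E → ℝ, K.MemDual ψ ∧ (∀ᵐ x ∂K.vol, ‖ψ x * K.w x‖ ≤ 1) ∧ K.pairing φ ψ = ‖φ‖ := by
  have hφ : AEStronglyMeasurable φ K.vol := (Lp.aestronglyMeasurable φ).mono_ac K.vol_ac_μX
  -- The norming functional is `sign φ / w`; the convention `0 / 0 = 0` gives the sign the value `0`
  -- where `φ` vanishes.
  have hm : AEStronglyMeasurable (fun x => φ x / |φ x| * K.u x : E → ℝ) K.vol := by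
    have := hφ.aemeasurable
    have hu := K.measurable_u
    exact AEMeasurable.aestronglyMeasurable (by fun_prop)
  have hb : ∀ᵐ x ∂K.vol, ‖φ x / |φ x| * K.u x * K.w x‖ ≤ 1 := by
    filter_upwards [K.w_pos] with x hx
    rw [u, mul_assoc, inv_mul_cancel₀ hx.ne', mul_one, norm_div, Real.norm_eq_abs, norm_abs_eq_norm,
      Real.norm_eq_abs]
    exact div_self_le_one _
  refine ⟨_, K.memDual_of_ae_le hm hb, hb, ?_⟩
  rw [K.norm_eq_integral]
  refine integral_congr_ae ?_
  filter_upwards [K.w_pos] with x hx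
  rw [norm_mul, Real.norm_eq_abs, Real.norm_of_nonneg hx.le, u]
  rcases eq_or_ne (φ x) 0 with h | h
  · simp [h]
  · have := abs_ne_zero.2 h
    field_simp
    rw [sq_abs]

lemma eq_of_forall_pairing {φ φ' : K.X}
    (h : ∀ ψ, K.MemDual ψ → K.pairing φ ψ = K.pairing φ' ψ) : φ = φ' := by
  obtain ⟨ψ, hψ, -, e⟩ := K.exists_norming (φ - φ')
  have h1 : K.dualFunctional ψ hψ (φ - φ') = 0 := by
    rw [map_sub, sub_eq_zero]; exact h ψ hψ
  rw [← sub_eq_zero, ← norm_eq_zero, ← e]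
  exact h1

/-! ## Density -/

/-- The function `β / w`, for a bounded continuous `β`. -/
noncomputable def test (β : BoundedContinuousFunction E ℝ) (x : E) : ℝ := β x * K.u x

lemma test_mul_w (β : BoundedContinuousFunction E ℝ) :
    (fun x => K.test β x * K.w x) =ᵐ[K.vol] β := by
  filter_upwards [K.w_pos] with x hx
  rw [test, u, mul_assoc, inv_mul_cancel₀ hx.ne', mul_one]

lemma memDual_test (β : BoundedContinuousFunction E ℝ) : K.MemDual (K.test β) := by
  refine K.memDual_of_ae_le (C := ‖β‖)
    (β.continuous.aestronglyMeasurable.mul K.measurable_u.aestronglyMeasurable) ?_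
  filter_upwards [K.test_mul_w β] with x hx
  rw [hx]
  exact β.norm_coe_le_norm x

/-- The element `β / w` of `H`, for a bounded continuous `β`. -/
noncomputable def testH (β : BoundedContinuousFunction E ℝ) : K.H :=
  (K.memDual_test β).memLp.toLp

lemma testH_ae_eq (β : BoundedContinuousFunction E ℝ) : K.testH β =ᵐ[K.vol] K.test β :=
  K.toLp_ae_eq _

/-- Multiplication by `w` preserves the norm from `H` to `L²(Ω)`, where bounded continuous functions
are dense; it sends `β / w` to `β`. -/
lemma dense_testH : DenseRange K.testH := by
  have := K.isFiniteMeasure_vol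
  refine Metric.denseRange_iff.2 fun φ r hr => ?_
  have h1 : MemLp (fun x => φ x * K.w x) 2 K.vol := K.memLp_two_μH_iff.1 (Lp.memLp φ)
  obtain ⟨β, hβ, -⟩ := h1.exists_boundedContinuous_eLpNorm_sub_le ENNReal.ofNat_ne_top
    (ε := ENNReal.ofReal (r / 2)) (by simpa using hr)
  refine ⟨β, ?_⟩
  rw [dist_eq_norm, Lp.norm_def, K.eLpNorm_two_μH]
  have e : (fun x => (φ - K.testH β : K.H) x * K.w x) =ᵐ[K.vol]
      (fun x => φ x * K.w x) - (β : E → ℝ) := by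
    filter_upwards [K.vol_ac_μH.ae_le (Lp.coeFn_sub φ (K.testH β)), K.testH_ae_eq β,
      K.test_mul_w β] with x h1 h2 h3
    rw [h1, Pi.sub_apply, Pi.sub_apply, h2, sub_mul, h3]
  rw [eLpNorm_congr_ae e]
  exact (ENNReal.toReal_le_of_le_ofReal (by linarith) hβ).trans_lt (by linarith)

lemma denseRange_embed : DenseRange K.embed := by
  have := K.isFiniteMeasure_vol
  refine Metric.denseRange_iff.2 fun φ r hr => ?_
  obtain ⟨β, hβ, -⟩ := (memLp_one_iff_integrable.2
    (K.integrable_mul_w φ)).exists_boundedContinuous_eLpNorm_sub_le ENNReal.one_ne_top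
    (ε := ENNReal.ofReal (r / 2)) (by simpa using hr)
  refine ⟨K.testH β, ?_⟩
  rw [dist_eq_norm, Lp.norm_def, K.eLpNorm_one_μX]
  have e : (fun x => (φ - K.embed (K.testH β) : K.X) x * K.w x) =ᵐ[K.vol]
      (fun x => φ x * K.w x) - (β : E → ℝ) := by
    filter_upwards [K.vol_ac_μX.ae_le (Lp.coeFn_sub φ (K.embed (K.testH β))),
      K.embed_ae_eq (K.testH β), K.testH_ae_eq β, K.test_mul_w β] with x h1 h2 h3 h4
    rw [h1, Pi.sub_apply, Pi.sub_apply, h2, h3, sub_mul, h4]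
  rw [eLpNorm_congr_ae e]
  exact (ENNReal.toReal_le_of_le_ofReal (by linarith) hβ).trans_lt (by linarith)

/-! ## The composition operators -/

/-- The growth rate of the reciprocal weight along the flow. -/
noncomputable def growth : ℝ := K.exists_growth.choose

lemma growth_nonneg : 0 ≤ K.growth := K.exists_growth.choose_spec.1

lemma u_comp_flow_le {t : ℝ} (ht : 0 ≤ t) :
    ∀ᵐ x ∂K.vol, K.u (K.flow t x) ≤ Real.exp (K.growth * t) * K.u x :=
  K.exists_growth.choose_spec.2 t ht

/-- The growth bound on `1/w` reads `w ≤ exp(κt) (w ∘ Φ^t)`, which moves the weight along with the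
flow. This gives boundedness of composition on `X*` directly, and on `H` after a change of measure.
-/
lemma ae_norm_comp_flow_le (ψ : E → ℝ) {t : ℝ} (ht : 0 ≤ t) : ∀ᵐ x ∂K.vol,
    ‖ψ (K.flow t x) * K.w x‖ ≤
      Real.exp (K.growth * t) * ‖ψ (K.flow t x) * K.w (K.flow t x)‖ := by
  filter_upwards [K.u_comp_flow_le ht, K.w_pos, K.ae_flow K.w_pos ht]
    with x h1 h2 h3
  rw [norm_mul, norm_mul, mul_left_comm, Real.norm_of_nonneg h2.le, Real.norm_of_nonneg h3.le]
  refine mul_le_mul_of_nonneg_left ?_ (norm_nonneg _)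
  rw [u, u, ← div_eq_mul_inv, le_div_iff₀ h2, inv_mul_le_iff₀ h3] at h1
  linarith

/-- The growth rate of the composition semigroup on `H`. -/
noncomputable def rate : ℝ := K.growth + d * K.lip / 2

lemma aestronglyMeasurable_comp_flow {ψ : E → ℝ} (h : AEStronglyMeasurable ψ K.vol) {t : ℝ}
    (ht : 0 ≤ t) : AEStronglyMeasurable (ψ ∘ K.flow t) K.vol :=
  h.comp_quasiMeasurePreserving (K.quasiMeasurePreserving_flow ht)

lemma eLpNorm_comp_flow_le {ψ : E → ℝ} (h : MemLp ψ 2 K.μH) {t : ℝ} (ht : 0 ≤ t) :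
    eLpNorm (ψ ∘ K.flow t) 2 K.μH ≤ ENNReal.ofReal (Real.exp (K.rate * t)) * eLpNorm ψ 2 K.μH := by
  have hw := (K.memLp_two_μH_iff.1 h).1
  have h1 : eLpNorm ((fun x => ψ x * K.w x) ∘ K.flow t) 2 K.vol ≤
      ENNReal.ofReal (Real.exp (d * K.lip / 2 * t)) * eLpNorm (fun x => ψ x * K.w x) 2 K.vol := by
    rw [← eLpNorm_map_measure
      (hw.mono_ac (K.quasiMeasurePreserving_flow ht).absolutelyContinuous)
      (K.measurable_flow t).aemeasurable]
    refine (eLpNorm_mono_measure _ (K.map_flow_le ht)).trans_eq ?_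
    -- The `L²` norm takes the square root of the compression factor, whence the summand `d * lip /
    -- 2` in `rate`.
    rw [eLpNorm_smul_measure_of_ne_top ENNReal.ofNat_ne_top, compression,
      ENNReal.ofReal_rpow_of_pos (Real.exp_pos _), ← Real.exp_mul, smul_eq_mul]
    congr 3
    simp
    ring
  rw [K.eLpNorm_two_μH, K.eLpNorm_two_μH]
  refine (eLpNorm_le_mul_eLpNorm_of_ae_le_mul (K.ae_norm_comp_flow_le ψ ht) 2).trans ?_
  refine (mul_le_mul_right h1 _).trans_eq ?_
  rw [← mul_assoc, ← ENNReal.ofReal_mul (Real.exp_pos _).le, ← Real.exp_add, rate, add_mul]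

lemma memLp_comp_flow {ψ : E → ℝ} (h : MemLp ψ 2 K.μH) {t : ℝ} (ht : 0 ≤ t) :
    MemLp (ψ ∘ K.flow t) 2 K.μH :=
  ⟨(K.aestronglyMeasurable_comp_flow (h.1.mono_ac K.vol_ac_μH) ht).mono_ac K.μH_ac_vol,
    (K.eLpNorm_comp_flow_le h ht).trans_lt (ENNReal.mul_lt_top ENNReal.ofReal_lt_top h.2)⟩

lemma memDual_comp_flow {ψ : E → ℝ} (h : K.MemDual ψ) {t : ℝ} (ht : 0 ≤ t) {C : ℝ}
    (hC : ∀ᵐ x ∂K.vol, ‖ψ x * K.w x‖ ≤ C) :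
    K.MemDual (ψ ∘ K.flow t) ∧
      ∀ᵐ x ∂K.vol, ‖(ψ ∘ K.flow t) x * K.w x‖ ≤ Real.exp (K.growth * t) * C := by
  have hb : ∀ᵐ x ∂K.vol, ‖(ψ ∘ K.flow t) x * K.w x‖ ≤ Real.exp (K.growth * t) * C := by
    filter_upwards [K.ae_norm_comp_flow_le ψ ht, K.ae_flow hC ht] with x h1 h2
    exact h1.trans (mul_le_mul_of_nonneg_left h2 (Real.exp_pos _).le)
  exact ⟨K.memDual_of_ae_le (K.aestronglyMeasurable_comp_flow
    (K.aestronglyMeasurable_of_mul_w h.1) ht) hb, hb⟩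

lemma comp_flow_ae_eq {ψ ψ' : E → ℝ} (h : ψ =ᵐ[K.vol] ψ') {t : ℝ} (ht : 0 ≤ t) :
    ψ ∘ K.flow t =ᵐ[K.vol] ψ' ∘ K.flow t := K.ae_flow h ht

lemma comp_forwardFlow_ae_eq (ψ : E → ℝ) {t : ℝ} (ht : 0 ≤ t) :
    ψ ∘ forwardFlow K.f t =ᵐ[K.vol] ψ ∘ K.flow t := by
  filter_upwards [K.ae_mem] with x hx
  rw [Function.comp, Function.comp, K.flow_eq (subset_closure hx) ht]

/-- The composition operator `ψ ↦ ψ ∘ Φ^t` on `H` (extended constantly to `t < 0`). -/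
noncomputable def koopman (t : ℝ) : K.H →L[ℝ] K.H :=
  LinearMap.mkContinuous
    { toFun := fun ψ => (K.memLp_comp_flow (Lp.memLp ψ) (le_max_right t 0)).toLp
      map_add' := by
        intro h k
        refine (MemLp.toLp_congr _ ((K.memLp_comp_flow (Lp.memLp h) (le_max_right t 0)).add
          (K.memLp_comp_flow (Lp.memLp k) (le_max_right t 0))) ?_).trans (MemLp.toLp_add _ _)
        exact K.μH_ac_vol.ae_le (K.comp_flow_ae_eq (K.vol_ac_μH.ae_le (Lp.coeFn_add h k))
          (le_max_right t 0))
      map_smul' := by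
        intro a h
        refine (MemLp.toLp_congr _ ((K.memLp_comp_flow (Lp.memLp h)
          (le_max_right t 0)).const_smul a) ?_).trans (MemLp.toLp_const_smul _ _)
        exact K.μH_ac_vol.ae_le (K.comp_flow_ae_eq (K.vol_ac_μH.ae_le (Lp.coeFn_smul a h))
          (le_max_right t 0)) }
    (Real.exp (K.rate * max t 0)) (by
      intro h
      change ‖(K.memLp_comp_flow (Lp.memLp h) (le_max_right t 0)).toLp‖ ≤ _
      rw [Lp.norm_toLp, Lp.norm_def, ← ENNReal.toReal_ofReal (Real.exp_pos (K.rate * max t 0)).le,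
        ← ENNReal.toReal_mul]
      exact ENNReal.toReal_mono
        (ENNReal.mul_lt_top ENNReal.ofReal_lt_top (Lp.eLpNorm_lt_top h)).ne
        (K.eLpNorm_comp_flow_le (Lp.memLp h) (le_max_right t 0)))

lemma norm_koopman_le {t : ℝ} (ht : 0 ≤ t) : ‖K.koopman t‖ ≤ Real.exp (K.rate * t) := by
  refine (LinearMap.mkContinuous_norm_le _ (Real.exp_pos _).le _).trans_eq ?_
  rw [max_eq_left ht]

lemma koopman_ae_eq (ψ : K.H) {t : ℝ} (ht : 0 ≤ t) : K.koopman t ψ =ᵐ[K.vol] ψ ∘ K.flow t := by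
  have := K.toLp_ae_eq (K.memLp_comp_flow (Lp.memLp ψ) (le_max_right t 0))
  refine this.trans (EventuallyEq.of_eq ?_)
  rw [max_eq_left ht]

/-! ## The semigroup on `H` -/

lemma isPreadjointH_adjoint {t : ℝ} (ht : 0 ≤ t) :
    K.IsPreadjointH t (K.koopman t).adjoint := by
  intro ρ ψ hψ
  have h1 : K.pairing ((K.koopman t).adjoint ρ) ψ =
      inner ℝ ((K.koopman t).adjoint ρ) (hψ.toLp ψ) := by
    rw [K.inner_eq_pairing]
    exact K.pairing_congr (ae_eq_refl _) (K.toLp_ae_eq hψ).symm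
  rw [h1, ContinuousLinearMap.adjoint_inner_left, K.inner_eq_pairing]
  refine K.pairing_congr (ae_eq_refl _) ?_
  exact (K.koopman_ae_eq _ ht).trans ((K.comp_flow_ae_eq (K.toLp_ae_eq hψ) ht).trans
    (K.comp_forwardFlow_ae_eq ψ ht).symm)

lemma SH_eq {t : ℝ} (ht : 0 ≤ t) : K.SH t = (K.koopman t).adjoint := by
  have h : ∃ T, K.IsPreadjointH t T := ⟨_, K.isPreadjointH_adjoint ht⟩
  rw [SH, dif_pos h]
  ext1 ρ
  refine ext_inner_right ℝ fun ψ => ?_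
  rw [K.inner_eq_pairing, K.inner_eq_pairing, h.choose_spec ρ ψ (Lp.memLp ψ),
    K.isPreadjointH_adjoint ht ρ ψ (Lp.memLp ψ)]

lemma koopman_zero (ψ : K.H) : K.koopman 0 ψ = ψ := by
  refine Lp.ext (K.μH_ac_vol.ae_le ?_)
  filter_upwards [K.koopman_ae_eq ψ le_rfl, K.ae_mem] with x h1 h2
  rw [h1, Function.comp, K.flow_zero (subset_closure h2)]

lemma koopman_add {s t : ℝ} (hs : 0 ≤ s) (ht : 0 ≤ t) (ψ : K.H) :
    K.koopman (s + t) ψ = K.koopman t (K.koopman s ψ) := by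
  refine Lp.ext (K.μH_ac_vol.ae_le ?_)
  filter_upwards [K.koopman_ae_eq ψ (add_nonneg hs ht), K.koopman_ae_eq (K.koopman s ψ) ht,
    K.comp_flow_ae_eq (K.koopman_ae_eq ψ hs) ht, K.ae_mem] with x h1 h2 h3 h4
  rw [h1, h2, h3, Function.comp, Function.comp, Function.comp, K.flow_add h4 hs ht]

lemma norm_sq_eq (φ : K.H) : ‖φ‖ ^ 2 = ∫ x, (φ x * K.w x) ^ 2 ∂K.vol := by
  rw [← real_inner_self_eq_norm_sq, K.inner_eq_pairing]
  exact integral_congr_ae (Eventually.of_forall fun x => by simp only; ring)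

lemma rate_nonneg : 0 ≤ K.rate := by
  have := K.growth_nonneg
  unfold rate
  positivity

lemma tendsto_koopman_testH (β : BoundedContinuousFunction E ℝ) :
    Tendsto (fun t => K.koopman t (K.testH β)) (𝓝[>] 0) (𝓝 (K.testH β)) := by
  have := K.isFiniteMeasure_vol
  -- The null set excluded by each almost everywhere bound depends on the time, so only countably
  -- many times are treated at once. The factor `β` converges by continuity, `u` by
  -- `exists_modulus`.
  refine tendsto_of_seq_tendsto fun s hs => ?_
  obtain ⟨hs0, hspos⟩ := tendsto_nhdsWithin_iff.1 hs
  obtain ⟨N, hN⟩ := eventually_atTop.1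
    (hspos.and (hs0.eventually (gt_mem_nhds zero_lt_one)))
  rw [← tendsto_add_atTop_iff_nat N]
  have hs0' := (tendsto_add_atTop_iff_nat N).2 hs0
  have hp : ∀ n, 0 < s (n + N) := fun n => (hN _ (Nat.le_add_left _ _)).1
  have hp1 : ∀ n, s (n + N) < 1 := fun n => (hN _ (Nat.le_add_left _ _)).2
  obtain ⟨C, hC⟩ := K.exists_modulus
  rw [tendsto_iff_norm_sub_tendsto_zero]
  have hsq : Tendsto (fun n => ‖K.koopman (s (n + N)) (K.testH β) - K.testH β‖ ^ 2) atTop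
      (𝓝 0) := by
    simp only [K.norm_sq_eq]
    have h0 : (0 : ℝ) = ∫ x, (0 : ℝ) ∂K.vol := by simp
    rw [h0]
    have hae : ∀ n, ∀ᵐ x ∂K.vol, (K.koopman (s (n + N)) (K.testH β) - K.testH β : K.H) x * K.w x =
        (β (K.flow (s (n + N)) x) * K.u (K.flow (s (n + N)) x) - β x * K.u x) * K.w x := fun n => by
      filter_upwards [K.vol_ac_μH.ae_le (Lp.coeFn_sub (K.koopman (s (n + N)) (K.testH β))
        (K.testH β)), K.koopman_ae_eq (K.testH β) (hp n).le, K.testH_ae_eq β,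
        K.comp_flow_ae_eq (K.testH_ae_eq β) (hp n).le] with x h1 h2 h3 h4
      rw [h1, Pi.sub_apply, h2, h4, h3]
      rfl
    refine tendsto_integral_filter_of_dominated_convergence
      (fun _ => (‖β‖ * (Real.exp K.growth + 1)) ^ 2) ?_ ?_ (integrable_const _) ?_
    · refine Eventually.of_forall fun n => ?_
      exact (K.aestronglyMeasurable_mul_w
        ((Lp.aestronglyMeasurable _).mono_ac K.vol_ac_μH)).pow 2
    · refine Eventually.of_forall fun n => ?_
      filter_upwards [hae n, K.u_comp_flow_le (hp n).le, K.u_pos,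
        K.ae_flow K.u_pos (hp n).le, K.w_pos] with x h1 h2 h3 h4 h5
      have hwu : K.u x * K.w x = 1 := inv_mul_cancel₀ h5.ne'
      rw [h1, norm_pow]
      refine pow_le_pow_left₀ (norm_nonneg _) ?_ 2
      have e1 : ‖β (K.flow (s (n + N)) x) * K.u (K.flow (s (n + N)) x)‖ ≤
          ‖β‖ * (Real.exp K.growth * K.u x) := by
        rw [norm_mul, Real.norm_of_nonneg h4.le]
        refine mul_le_mul (β.norm_coe_le_norm _) (h2.trans ?_) h4.le (norm_nonneg _)
        refine mul_le_mul_of_nonneg_right (Real.exp_le_exp.2 ?_) h3.le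
        nlinarith [K.growth_nonneg, hp1 n]
      have e2 : ‖β x * K.u x‖ ≤ ‖β‖ * K.u x := by
        rw [norm_mul, Real.norm_of_nonneg h3.le]
        exact mul_le_mul_of_nonneg_right (β.norm_coe_le_norm _) h3.le
      rw [norm_mul, Real.norm_of_nonneg h5.le]
      calc _ ≤ (‖β‖ * (Real.exp K.growth * K.u x) + ‖β‖ * K.u x) * K.w x :=
            mul_le_mul_of_nonneg_right ((norm_sub_le _ _).trans (add_le_add e1 e2)) h5.le
        _ = ‖β‖ * (Real.exp K.growth + 1) * (K.u x * K.w x) := by ring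
        _ = _ := by rw [hwu, mul_one]
    · filter_upwards [ae_all_iff.2 hae, ae_all_iff.2 fun n => hC _ (hp n).le, K.ae_mem]
        with x h1 h2 h3
      simp only [h1]
      have hfl : Tendsto (fun n => K.flow (s (n + N)) x) atTop (𝓝 x) := by
        have hc := K.continuousOn_flow (subset_closure h3) 0 self_mem_Ici
        rw [ContinuousWithinAt, K.flow_zero (subset_closure h3)] at hc
        exact hc.comp (tendsto_nhdsWithin_iff.2 ⟨hs0', Eventually.of_forall fun n => (hp n).le⟩)
      have hu : Tendsto (fun n => K.u (K.flow (s (n + N)) x)) atTop (𝓝 (K.u x)) := by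
        rw [tendsto_iff_dist_tendsto_zero]
        refine squeeze_zero (fun _ => dist_nonneg) (fun n => h2 n) ?_
        simpa using hs0'.const_mul C
      have hβ := (β.continuous.tendsto x).comp hfl
      have := (((hβ.mul hu).sub_const (β x * K.u x)).mul_const (K.w x)).pow 2
      simpa using this
  have := hsq.sqrt
  simpa using this

lemma tendsto_koopman (φ : K.H) :
    Tendsto (fun t => K.koopman t φ) (𝓝[>] 0) (𝓝 φ) := by
  rw [Metric.tendsto_nhds]
  intro ε hε
  set D := Real.exp K.rate + 1 with hD
  have hDpos : 0 < D := by positivity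
  obtain ⟨β, hβ⟩ := Metric.denseRange_iff.1 K.dense_testH φ (ε / (2 * D)) (by positivity)
  filter_upwards [Metric.tendsto_nhds.1 (K.tendsto_koopman_testH β) (ε / 2) (by positivity),
    self_mem_nhdsWithin, nhdsWithin_le_nhds (gt_mem_nhds zero_lt_one)] with t h1 h2 h3
  have h2 : 0 < t := h2
  have h4 : dist (K.koopman t φ) (K.koopman t (K.testH β)) ≤
      Real.exp K.rate * dist φ (K.testH β) := by
    rw [dist_eq_norm, ← map_sub, dist_eq_norm]
    refine (K.koopman t).le_of_opNorm_le ((K.norm_koopman_le h2.le).trans ?_) _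
    exact Real.exp_le_exp.2 (by nlinarith [K.rate_nonneg])
  calc dist (K.koopman t φ) φ ≤ dist (K.koopman t φ) (K.koopman t (K.testH β)) +
        dist (K.koopman t (K.testH β)) (K.testH β) + dist (K.testH β) φ := dist_triangle4 _ _ _ _
    _ ≤ D * dist φ (K.testH β) + dist (K.koopman t (K.testH β)) (K.testH β) := by
        rw [dist_comm (K.testH β) φ, hD, add_mul]; linarith
    _ < D * (ε / (2 * D)) + ε / 2 :=
        add_lt_add_of_le_of_lt (mul_le_mul_of_nonneg_left hβ.le hDpos.le) h1
    _ = ε := by field_simp; ring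

lemma norm_SH_le {t : ℝ} (ht : 0 ≤ t) : ‖K.SH t‖ ≤ Real.exp (K.rate * t) := by
  rw [K.SH_eq ht, LinearIsometryEquiv.norm_map]
  exact K.norm_koopman_le ht

/-- The semigroup on `H` is strongly continuous. -/
lemma isC0Semigroup_SH : IsC0Semigroup K.SH K.rate where
  zero φ := by
    rw [K.SH_eq le_rfl]
    refine ext_inner_right ℝ fun ψ => ?_
    rw [ContinuousLinearMap.adjoint_inner_left, K.koopman_zero]
  add s t hs ht φ := by
    rw [K.SH_eq (add_nonneg hs ht), K.SH_eq hs, K.SH_eq ht]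
    refine ext_inner_right ℝ fun ψ => ?_
    simp only [ContinuousLinearMap.adjoint_inner_left]
    rw [K.koopman_add hs ht]
  norm_le t ht := K.norm_SH_le ht
  tendsto_zero φ := by
    -- This expression bounds `‖S(t)φ - φ‖² = ‖S(t)φ‖² - 2⟨φ, koopman t φ⟩ + ‖φ‖²`. It tends to `0`
    -- because the bound `exp (rate * t)` on the norm tends to `1`; a bound with a larger leading
    -- constant would not do.
    have hlim : Tendsto (fun t => (Real.exp (K.rate * t) ^ 2 + 1) * ‖φ‖ ^ 2 -
        2 * inner ℝ φ (K.koopman t φ)) (𝓝[>] 0) (𝓝 0) := by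
      have h1 : Tendsto (fun t => (Real.exp (K.rate * t) ^ 2 + 1) * ‖φ‖ ^ 2) (𝓝[>] 0)
          (𝓝 ((Real.exp (K.rate * 0) ^ 2 + 1) * ‖φ‖ ^ 2)) := by
        have : Continuous fun t => (Real.exp (K.rate * t) ^ 2 + 1) * ‖φ‖ ^ 2 := by fun_prop
        exact (this.tendsto 0).mono_left nhdsWithin_le_nhds
      have h2 := ((tendsto_const_nhds (x := φ)).inner (𝕜 := ℝ) (K.tendsto_koopman φ)).const_mul 2
      have := h1.sub h2
      rw [real_inner_self_eq_norm_sq, mul_zero, Real.exp_zero] at this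
      convert this using 2
      ring
    rw [tendsto_iff_norm_sub_tendsto_zero]
    have hsq : Tendsto (fun t => ‖K.SH t φ - φ‖ ^ 2) (𝓝[>] 0) (𝓝 0) := by
      refine squeeze_zero' (Eventually.of_forall fun _ => sq_nonneg _) ?_ hlim
      filter_upwards [self_mem_nhdsWithin] with t ht
      have ht : 0 ≤ t := le_of_lt ht
      rw [norm_sub_sq_real, K.SH_eq ht, ContinuousLinearMap.adjoint_inner_left, ← K.SH_eq ht]
      have h1 : ‖K.SH t φ‖ ≤ Real.exp (K.rate * t) * ‖φ‖ :=
        (K.SH t).le_of_opNorm_le (K.norm_SH_le ht) φ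
      have h2 := pow_le_pow_left₀ (norm_nonneg _) h1 2
      rw [mul_pow] at h2
      linarith
    simpa using hsq.sqrt

/-! ## The semigroup on `X` -/

/-- Duality: a norming `ψ` for `S(t)ρ` in `X` is composed with the flow, which costs only the growth
of `1/w` and no volume factor. -/
lemma norm_embed_SH_le {t : ℝ} (ht : 0 ≤ t) (ρ : K.H) :
    ‖K.embed (K.SH t ρ)‖ ≤ Real.exp (K.growth * t) * ‖K.embed ρ‖ := by
  obtain ⟨ψ, hψ, hb, e⟩ := K.exists_norming (K.embed (K.SH t ρ))
  obtain ⟨hd, hdb⟩ := K.memDual_comp_flow hψ ht hb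
  rw [mul_one] at hdb
  have h1 : K.pairing (K.embed (K.SH t ρ)) ψ = K.pairing (K.embed ρ) (ψ ∘ K.flow t) := by
    rw [K.pairing_congr (K.embed_ae_eq _) (ae_eq_refl ψ), K.SH_eq ht,
      K.isPreadjointH_adjoint ht ρ ψ hψ.memLp]
    exact K.pairing_congr (K.embed_ae_eq _).symm (K.comp_forwardFlow_ae_eq ψ ht)
  rw [← e, h1]
  refine (le_abs_self _).trans ((K.abs_pairing_le _ hd).trans ?_)
  exact mul_le_mul_of_nonneg_right (K.dualNorm_le_of_ae_le (Real.exp_pos _).le hdb) (norm_nonneg _)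

/-- An operator on `X*` need not have a preadjoint on `X`. It is obtained here by extending `S(t)`
from `H` in the norm of `X`; the duality relation passes to the limit. -/
lemma exists_isPreadjointX {t : ℝ} (ht : 0 ≤ t) :
    ∃ T, K.IsPreadjointX t T ∧ ∀ ρ, T (K.embed ρ) = K.embed (K.SH t ρ) := by
  let T : K.X →L[ℝ] K.X :=
    ((K.embed ∘L K.SH t : K.H →L[ℝ] K.X) : K.H →ₗ[ℝ] K.X).extendOfNorm (K.embed : K.H →ₗ[ℝ] K.X)
  have hT : ∀ ρ, T (K.embed ρ) = K.embed (K.SH t ρ) := fun ρ =>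
    LinearMap.extendOfNorm_eq (e := (K.embed : K.H →ₗ[ℝ] K.X)) K.denseRange_embed
      ⟨_, K.norm_embed_SH_le ht⟩ ρ
  refine ⟨T, fun ρ ψ hψ => ?_, hT⟩
  obtain ⟨hd, -⟩ := K.memDual_comp_flow hψ ht (K.ae_le_dualNorm hψ)
  have hfun : (K.dualFunctional ψ hψ) ∘ T = K.dualFunctional _ hd := by
    refine K.denseRange_embed.equalizer ((ContinuousLinearMap.continuous _).comp T.continuous)
      (ContinuousLinearMap.continuous _) ?_
    ext1 η
    change K.pairing (T (K.embed η)) ψ = K.pairing (K.embed η) (ψ ∘ K.flow t)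
    rw [hT, K.pairing_congr (K.embed_ae_eq _) (ae_eq_refl ψ), K.SH_eq ht,
      K.isPreadjointH_adjoint ht η ψ hψ.memLp]
    exact K.pairing_congr (K.embed_ae_eq _).symm (K.comp_forwardFlow_ae_eq ψ ht)
  exact (congrFun hfun ρ).trans
    (K.pairing_congr (ae_eq_refl _) (K.comp_forwardFlow_ae_eq ψ ht).symm)

/-- The semigroup on `X` extends the semigroup on `H`. -/
lemma SX_embed {t : ℝ} (ht : 0 ≤ t) (ρ : K.H) : K.SX t (K.embed ρ) = K.embed (K.SH t ρ) := by
  obtain ⟨T, hT, hTe⟩ := K.exists_isPreadjointX ht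
  have h : ∃ T, K.IsPreadjointX t T := ⟨T, hT⟩
  rw [← hTe, SX, dif_pos h]
  refine K.eq_of_forall_pairing fun ψ hψ => ?_
  rw [h.choose_spec _ ψ hψ, hT _ ψ hψ]

end KoopmanSystem

namespace KoopmanSystem.NuclearCost

variable {d : ℕ} {K : KoopmanSystem d} (N : K.NuclearCost)

/-! ## The value bilinear form -/

/-- The observation on `H`. -/
noncomputable def CH : K.H →L[ℝ] lp (fun _ : ℕ => ℝ) 2 := N.C ∘L K.embed

lemma C_SX_embed {t : ℝ} (ht : 0 ≤ t) (φ : K.H) :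
    N.C (K.SX t (K.embed φ)) = N.CH (K.SH t φ) := by
  rw [K.SX_embed ht]; rfl

lemma continuousOn_CH_SH (φ : K.H) : ContinuousOn (fun t => N.CH (K.SH t φ)) (Ici 0) :=
  N.CH.continuous.comp_continuousOn (K.isC0Semigroup_SH.continuousOn φ)

/-- Strong continuity is available on `H` only; an observed orbit in `X` is a pointwise limit of
continuous ones that start in `H`. -/
lemma aestronglyMeasurable_C_SX (φ : K.X) :
    AEStronglyMeasurable (fun t => N.C (K.SX t φ)) (volume.restrict (Ioi 0)) := by
  obtain ⟨y, hy, hlim⟩ := mem_closure_iff_seq_limit.1 (K.denseRange_embed φ)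
  choose η hη using hy
  refine aestronglyMeasurable_of_tendsto_ae atTop (f := fun n t => N.C (K.SX t (y n)))
    (fun n => ?_) (Eventually.of_forall fun t => ?_)
  · have h1 := ((N.continuousOn_CH_SH (η n)).mono Ioi_subset_Ici_self).aestronglyMeasurable
      (μ := volume) measurableSet_Ioi
    refine h1.congr ?_
    filter_upwards [ae_restrict_mem measurableSet_Ioi] with t ht
    rw [← hη n, N.C_SX_embed (le_of_lt ht)]
  · exact ((N.C.continuous.comp (K.SX t).continuous).tendsto φ).comp hlim

lemma abs_inner_C_SX_le {M ω : ℝ} (hM : ∀ t, 0 ≤ t → ‖K.SX t‖ ≤ M * Real.exp (-ω * t))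
    (φ ψ : K.X) {t : ℝ} (ht : 0 ≤ t) :
    ‖(inner ℝ (N.C (K.SX t φ)) (N.C (K.SX t ψ)) : ℝ)‖ ≤
      ((‖N.C‖ * M) ^ 2 * ‖φ‖ * ‖ψ‖) * Real.exp (-(2 * ω) * t) := by
  have hb : ∀ η : K.X, ‖N.C (K.SX t η)‖ ≤ ‖N.C‖ * (M * Real.exp (-ω * t) * ‖η‖) := fun η =>
    (N.C.le_opNorm _).trans (mul_le_mul_of_nonneg_left ((K.SX t).le_of_opNorm_le (hM t ht) η)
      (norm_nonneg _))
  refine (norm_inner_le_norm _ _).trans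
    ((mul_le_mul (hb φ) (hb ψ) (norm_nonneg _) ((norm_nonneg _).trans (hb φ))).trans_eq ?_)
  have e : Real.exp (-(2 * ω) * t) = Real.exp (-ω * t) * Real.exp (-ω * t) := by
    rw [← Real.exp_add]; ring_nf
  rw [e]
  ring

lemma integrableOn_inner (hS : ExponentiallyStable K.SX) (φ ψ : K.X) :
    IntegrableOn (fun t => (inner ℝ (N.C (K.SX t φ)) (N.C (K.SX t ψ)) : ℝ)) (Ioi 0) := by
  obtain ⟨M, ω, hω, hM⟩ := hS
  refine Integrable.mono' ((exp_neg_integrableOn_Ioi 0 (by positivity : 0 < 2 * ω)).const_mul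
    ((‖N.C‖ * M) ^ 2 * ‖φ‖ * ‖ψ‖))
    ((N.aestronglyMeasurable_C_SX φ).inner (N.aestronglyMeasurable_C_SX ψ)) ?_
  filter_upwards [ae_restrict_mem measurableSet_Ioi] with t ht
  exact N.abs_inner_C_SX_le hM φ ψ (le_of_lt ht)

lemma exists_continuous_valueForm (hS : ExponentiallyStable K.SX) :
    ∃ P : K.X →L[ℝ] K.X →L[ℝ] ℝ, ∀ φ ψ, P φ ψ = N.valueForm φ ψ := by
  have hi := N.integrableOn_inner hS
  let P₀ : K.X →ₗ[ℝ] K.X →ₗ[ℝ] ℝ := LinearMap.mk₂ ℝ N.valueForm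
    (fun φ φ' ψ => by
      rw [valueForm, valueForm, valueForm, ← integral_add (hi φ ψ) (hi φ' ψ)]
      simp only [map_add, inner_add_left])
    (fun a φ ψ => by
      rw [valueForm, valueForm, smul_eq_mul, ← integral_const_mul]
      simp only [map_smul, real_inner_smul_left])
    (fun φ ψ ψ' => by
      rw [valueForm, valueForm, valueForm, ← integral_add (hi φ ψ) (hi φ ψ')]
      simp only [map_add, inner_add_right])
    (fun a φ ψ => by
      rw [valueForm, valueForm, smul_eq_mul, ← integral_const_mul]
      simp only [map_smul, real_inner_smul_right])
  obtain ⟨M, ω, hω, hM⟩ := hS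
  refine ⟨P₀.mkContinuous₂
    ((‖N.C‖ * M) ^ 2 * ∫ t in Ioi (0 : ℝ), Real.exp (-(2 * ω) * t)) fun φ ψ => ?_, fun φ ψ => rfl⟩
  have h := norm_integral_le_of_norm_le (μ := volume.restrict (Ioi 0))
    ((exp_neg_integrableOn_Ioi 0 (by positivity : 0 < 2 * ω)).const_mul
      ((‖N.C‖ * M) ^ 2 * ‖φ‖ * ‖ψ‖))
    ((ae_restrict_mem measurableSet_Ioi).mono fun t ht =>
      N.abs_inner_C_SX_le hM φ ψ (le_of_lt ht))
  rw [integral_const_mul] at h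
  refine h.trans_eq ?_
  ring

/-! ## The Lyapunov equation -/

/-- The observed correlation of two trajectories in `H`. -/
noncomputable def corr (φ ψ : K.H) (t : ℝ) : ℝ := inner ℝ (N.CH (K.SH t φ)) (N.CH (K.SH t ψ))

lemma continuousOn_corr (φ ψ : K.H) : ContinuousOn (N.corr φ ψ) (Ici 0) :=
  (N.continuousOn_CH_SH φ).inner (𝕜 := ℝ) (N.continuousOn_CH_SH ψ)

lemma valueForm_embed (φ ψ : K.H) :
    N.valueForm (K.embed φ) (K.embed ψ) = ∫ t in Ioi (0 : ℝ), N.corr φ ψ t :=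
  setIntegral_congr_fun measurableSet_Ioi fun t ht => by
    simp only [corr, N.C_SX_embed (le_of_lt ht)]

lemma integrableOn_corr (hS : ExponentiallyStable K.SX) (φ ψ : K.H) :
    IntegrableOn (N.corr φ ψ) (Ioi 0) :=
  (N.integrableOn_inner hS (K.embed φ) (K.embed ψ)).congr_fun
    (fun t ht => by simp only [corr, N.C_SX_embed (le_of_lt ht)]) measurableSet_Ioi

lemma corr_SH (φ ψ : K.H) {s t : ℝ} (hs : 0 ≤ s) (ht : 0 ≤ t) :
    N.corr (K.SH s φ) (K.SH s ψ) t = N.corr φ ψ (t + s) := by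
  rw [corr, corr, K.isC0Semigroup_SH.add t s ht hs, K.isC0Semigroup_SH.add t s ht hs]

lemma valueForm_SH (hS : ExponentiallyStable K.SX) (φ ψ : K.H) {s : ℝ} (hs : 0 ≤ s) :
    N.valueForm (K.embed (K.SH s φ)) (K.embed (K.SH s ψ)) =
      N.valueForm (K.embed φ) (K.embed ψ) - ∫ t in (0 : ℝ)..s, N.corr φ ψ t := by
  have h1 : ∫ t in Ioi (0 : ℝ), N.corr (K.SH s φ) (K.SH s ψ) t = ∫ t in Ioi s, N.corr φ ψ t := by
    have e := (measurePreserving_add_right volume s).setIntegral_preimage_emb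
      (measurableEmbedding_addRight s) (N.corr φ ψ) (Ioi s)
    rw [← e]
    have : (fun t : ℝ => t + s) ⁻¹' Ioi s = Ioi 0 := by ext t; simp
    rw [this]
    exact setIntegral_congr_fun measurableSet_Ioi fun t ht => N.corr_SH φ ψ hs (le_of_lt ht)
  have hi := N.integrableOn_corr hS φ ψ
  rw [valueForm_embed, valueForm_embed, h1, intervalIntegral.integral_of_le hs,
    ← Ioc_union_Ioi_eq_Ioi hs, setIntegral_union (Ioc_disjoint_Ioi le_rfl) measurableSet_Ioi
      (hi.mono_set Ioc_subset_Ioi_self) (hi.mono_set (Ioi_subset_Ioi hs)), add_sub_cancel_left]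

/-- The right derivative of `s ↦ B(S(s)φ, S(s)ψ)` at `0` is computed twice: by the product rule, and
from `valueForm_SH`. -/
lemma valueForm_lyapunov (hS : ExponentiallyStable K.SX) {B : K.H →L[ℝ] K.H →L[ℝ] ℝ}
    (hB : ∀ φ ψ, B φ ψ = N.valueForm (K.embed φ) (K.embed ψ)) (φ ψ : K.A.domain) :
    B (K.A φ) ψ + B φ (K.A ψ) + inner ℝ (N.C (K.embed φ)) (N.C (K.embed ψ)) = 0 := by
  have h := K.isC0Semigroup_SH
  have hφ := h.hasDerivWithinAt φ le_rfl
  have hψ := h.hasDerivWithinAt ψ le_rfl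
  have d1 := (B.hasFDerivAt.comp_hasDerivWithinAt (0 : ℝ) hφ).clm_apply hψ
  simp only [Function.comp, h.zero] at d1
  have hc := N.continuousOn_corr (φ : K.H) (ψ : K.H)
  have d2 : HasDerivWithinAt (fun r => ∫ t in (0 : ℝ)..r, N.corr φ ψ t) (N.corr φ ψ 0)
      (Ioi 0) 0 := by
    refine (intervalIntegral.integral_hasDerivWithinAt_right (by simp) (s := Ici 0) (t := Ioi 0)
      ?_ ?_).mono Ioi_subset_Ici_self
    · exact ⟨Ioi 0, self_mem_nhdsWithin,
        (hc.mono Ioi_subset_Ici_self).aestronglyMeasurable measurableSet_Ioi⟩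
    · exact (hc 0 self_mem_Ici).mono Ioi_subset_Ici_self
  have d3 : HasDerivWithinAt (fun s => B (K.SH s φ) (K.SH s ψ)) (-N.corr φ ψ 0) (Ioi 0) 0 := by
    refine (d2.const_sub (B φ ψ)).congr (fun s hs => ?_) ?_
    · rw [hB, hB, N.valueForm_SH hS _ _ (le_of_lt hs)]
    · simp [h.zero]
  have key := (uniqueDiffWithinAt_Ioi (0 : ℝ)).eq_deriv _ d1 d3
  have e : N.corr φ ψ 0 = inner ℝ (N.C (K.embed φ)) (N.C (K.embed ψ)) := by
    rw [corr, h.zero, h.zero]; rfl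
  rw [e] at key
  change B (K.A φ) ψ + B φ (K.A ψ) = _ at key
  rw [key, neg_add_cancel]

lemma isLyapunovSolution_valueForm (hS : ExponentiallyStable K.SX) {B : K.H →L[ℝ] K.H →L[ℝ] ℝ}
    (hB : ∀ φ ψ, B φ ψ = N.valueForm (K.embed φ) (K.embed ψ)) : N.IsLyapunovSolution B := by
  refine ⟨fun φ ψ => ?_, fun φ => ?_, N.valueForm_lyapunov hS hB⟩
  · rw [hB, hB, valueForm, valueForm]
    exact integral_congr_ae (Eventually.of_forall fun t => real_inner_comm _ _)
  · rw [hB, valueForm]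
    exact integral_nonneg fun t => real_inner_self_nonneg

/-- On the domain, `lyapunov_identity` and positivity of `B'` bound the energy observed up to any
time by `B' φ φ`; the inequality is closed, so density finishes. -/
lemma valueForm_le (hS : ExponentiallyStable K.SX) {B B' : K.H →L[ℝ] K.H →L[ℝ] ℝ}
    (hB : ∀ φ ψ, B φ ψ = N.valueForm (K.embed φ) (K.embed ψ)) (hB' : N.IsLyapunovSolution B')
    (φ : K.H) : B φ φ ≤ B' φ φ := by
  have h := K.isC0Semigroup_SH
  have hcl : IsClosed {φ : K.H | B φ φ ≤ B' φ φ} :=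
    isClosed_le (B.continuous.clm_apply continuous_id) (B'.continuous.clm_apply continuous_id)
  refine closure_minimal (fun φ hφ => ?_) hcl (h.dense_domain φ)
  have hlim := intervalIntegral_tendsto_integral_Ioi 0 (N.integrableOn_corr hS φ φ) tendsto_id
  rw [mem_ofPred_eq, hB, valueForm_embed]
  refine le_of_tendsto hlim ?_
  filter_upwards [eventually_ge_atTop (0 : ℝ)] with t ht
  have key := h.lyapunov_identity N.CH B' hB'.2.2 ⟨φ, hφ⟩ ht
  have e : ∫ s in (0 : ℝ)..t, N.corr φ φ s = ∫ s in (0 : ℝ)..t, ‖N.CH (K.SH s φ)‖ ^ 2 := by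
    simp only [corr, real_inner_self_eq_norm_sq]
  rw [id, e, key]
  exact sub_le_self _ (hB'.2.1 _)

/-- Two minimal solutions agree on the diagonal, and symmetric forms are determined there by
polarization. -/
lemma IsMinimalLyapunovSolution.unique {N : K.NuclearCost} {B B' : K.H →L[ℝ] K.H →L[ℝ] ℝ}
    (h : N.IsMinimalLyapunovSolution B) (h' : N.IsMinimalLyapunovSolution B') : B = B' := by
  have hd : ∀ φ, B φ φ = B' φ φ := fun φ => le_antisymm (h.2 _ h'.1 φ) (h'.2 _ h.1 φ)
  ext φ ψ
  have h1 := hd (φ + ψ)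
  simp only [map_add, add_apply] at h1
  have h2 := h.1.1 φ ψ
  have h3 := h'.1.1 φ ψ
  linarith [hd φ, hd ψ]

end KoopmanSystem.NuclearCost

/-! ### Restriction of the value form to `H` and its unique extension -/

theorem mainTheorem5 {d : ℕ} (K : KoopmanSystem d) (N : K.NuclearCost)
    (hS : ExponentiallyStable K.SX) :
    -- the integrals that define the value bilinear form converge
    (∀ φ ψ : K.X,
      IntegrableOn (fun t => (inner ℝ (N.C (K.SX t φ)) (N.C (K.SX t ψ)) : ℝ)) (Ioi 0)) ∧
    -- there is exactly one minimal solution on `H`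
    ∃ PH : K.H →L[ℝ] K.H →L[ℝ] ℝ, N.IsMinimalLyapunovSolution PH ∧
      (∀ B, N.IsMinimalLyapunovSolution B → B = PH) ∧
      -- the value bilinear form is its unique bounded extension to `X`
      ∃ P : K.X →L[ℝ] K.X →L[ℝ] ℝ, (∀ φ ψ, P φ ψ = N.valueForm φ ψ) ∧
        (∀ φ ψ : K.H, P (K.embed φ) (K.embed ψ) = PH φ ψ) ∧
        ∀ Q : K.X →L[ℝ] K.X →L[ℝ] ℝ,
          (∀ φ ψ : K.H, Q (K.embed φ) (K.embed ψ) = PH φ ψ) → Q = P := by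
  obtain ⟨P, hP⟩ := N.exists_continuous_valueForm hS
  have hPH : ∀ φ ψ, P.bilinearComp K.embed K.embed φ ψ = N.valueForm (K.embed φ) (K.embed ψ) :=
    fun φ ψ => hP _ _
  have hmin : N.IsMinimalLyapunovSolution (P.bilinearComp K.embed K.embed) :=
    ⟨N.isLyapunovSolution_valueForm hS hPH, fun B' hB' => N.valueForm_le hS hPH hB'⟩
  refine ⟨N.integrableOn_inner hS, P.bilinearComp K.embed K.embed, hmin,
    fun B hB => hB.unique hmin, P, hP, fun φ ψ => rfl, fun Q hQ => ?_⟩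
  -- Density of `H` in `X` is used in one argument at a time: in the second here, in the first
  -- below.
  have h1 : ∀ φ : K.H, Q (K.embed φ) = P (K.embed φ) := fun φ =>
    DFunLike.coe_injective (K.denseRange_embed.equalizer (Q (K.embed φ)).continuous
      (P (K.embed φ)).continuous (funext fun ψ => hQ φ ψ))
  exact DFunLike.coe_injective
    (K.denseRange_embed.equalizer Q.continuous P.continuous (funext h1))
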